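/- Let $D=(V,A)$ be a directed graph with $n\ge 1$ nodes and $A\subseteq V\times V$, with integer capacities $0\le l_{ij}\le u_{ij}<\infty$ on the arcs, integer flow balances $b_i$ on the nodes and two real arc cost functions $c^1,c^2$. A flow is an integer vector $f\in\mathbb Z^A$ with $l\le f\le u$ and $\sum_{j:(i,j)\in A}f_{ij}-\sum_{j:(j,i)\in A}f_{ji}=b_i$ for all $i\in V$. For arc costs $w$, a flow is $w$-optimal if it minimizes $\sum_{a\in A}w_af_a$ over all flows. The residual graph $D_f$ has an arc from $i$ to $j$ of residual cost $w_{ij}$ for every $(i,j)\in A$ with $f_{ij}<u_{ij}$, and an arc from $j$ to $i$ of residual cost $-w_{ij}$ for every $(i,j)\in A$ with $f_{ij}>l_{ij}$. The cost $w(C)$ of a directed cycle $C$ (visiting no node twice) in $D_f$ is the sum of the residual costs of its arcs; $C$ is proper if it does not traverse an arc of $A$ in both directions. Let $\lambda_1,\lambda_2>0$, $w=\lambda_1c^1+\lambda_2c^2$, let $f'$ be a $w$-optimal flow, and let $y\in\mathbb R^V$ be an optimal node potential for $f'$ and $w$, i.e. for every arc of $D_{f'}$ from $i$ to $j$, of residual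 cost $r$ with respect to $w$, one has $r+y_i-y_j\ge 0$. The reduced network $D'_\lambda$ arises from $D$ by deleting the set $\mathcal X$ of all arcs $(i,j)\in A$ with $w_{ij}+y_i-y_j\ne 0$ and replacing $b_i$ by $b_i-\sum_{(i,j)\in\mathcal X}f'_{ij}+\sum_{(j,i)\in\mathcal X}f'_{ji}$. Let $D'_{\lambda,f'}$ be the residual graph of $D'_\lambda$ with respect to (the restriction of) $f'$. Assume that $f'$ is $c^1$-optimal in $D'_\lambda$. Then a minimum cost cycle $$C\in\operatorname{argmin}\{c^1(C): C \text{ a cycle in } D'_{\lambda,f'},\ c^1(C)>0\}$$ can be determined in $\mathcal O(n^3)$ time. Precisely, there are a single program for the random access machine with unit-cost operations (addition, subtraction and comparison of natural numbers, which also serve as addresses; addition, subtraction, multiplication and comparison of reals) and a constant $K$ such that, for all data as above, the program, given $D,l,u,b,c^1,c^2,\lambda,f'$ (arc data as $n\times n$ matrices) but not $y$, halts after at most $Kn^3$ steps and outputs a proper cycle $C$ in $D'_{\lambda,f'}$ with $c^1(C)>0$ that minimizes $c^1$ among all cycles of $D'_{\lambda,f'}$ of strictly positive cost $c^1$, or the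 empty list if there is no such cycle. -/

import Mathlib

/-! ### Integer flow networks -/

/-- A capacitated directed graph on the `n` nodes `Fin n`, with arc set `A`, integer capacity bounds
`0 ≤ l ≤ u` and flow balances `b`.  Only the values of `l`, `u` on `A` matter. -/
structure Network (n : ℕ) where
  A : Finset (Fin n × Fin n)
  l : Fin n × Fin n → ℤ
  u : Fin n × Fin n → ℤ
  b : Fin n → ℤ
  l_nonneg : ∀ a ∈ A, 0 ≤ l a

namespace Network

variable {n : ℕ}

/-- `f` is a feasible integer flow (only its values on `A` matter). -/
def IsFlow (N : Network n) (f : Fin n × Fin n → ℤ) : Prop :=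
  (∀ a ∈ N.A, N.l a ≤ f a ∧ f a ≤ N.u a) ∧
  ∀ i, ∑ a ∈ N.A with a.1 = i, f a - ∑ a ∈ N.A with a.2 = i, f a = N.b i

/-- Cost of a flow with respect to the arc costs `w`. -/
def cost (N : Network n) (w : Fin n × Fin n → ℝ) (f : Fin n × Fin n → ℤ) : ℝ :=
  ∑ a ∈ N.A, w a * (f a : ℝ)

/-- `f` is a minimum cost integer flow with respect to the arc costs `w`. -/
def IsOptimalFlow (N : Network n) (w : Fin n × Fin n → ℝ) (f : Fin n × Fin n → ℤ) : Prop :=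
  N.IsFlow f ∧ ∀ g, N.IsFlow g → N.cost w f ≤ N.cost w g

/-- Reduced cost of the arc `a = (i, j)` with respect to the node potential `y`. -/
def reducedCost (w : Fin n × Fin n → ℝ) (y : Fin n → ℝ) (a : Fin n × Fin n) : ℝ :=
  w a + y a.1 - y a.2

end Network

/-! ### Residual graphs and their cycles -/

/-- A (potential) residual arc: an arc `(i, j)` of the network, traversed forwards from `i` to `j`
or backwards from `j` to `i`.  Recording the underlying arc keeps the residual costs well defined
when the network has both `(i, j)` and `(j, i)` as arcs. -/
structure ResArc (n : ℕ) where
  arc : Fin n × Fin n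
  fwd : Bool

namespace ResArc

variable {n : ℕ}

def src (e : ResArc n) : Fin n := if e.fwd then e.arc.1 else e.arc.2

def dst (e : ResArc n) : Fin n := if e.fwd then e.arc.2 else e.arc.1

/-- The same arc, traversed in the opposite direction. -/
def rev (e : ResArc n) : ResArc n := ⟨e.arc, !e.fwd⟩

/-- Residual cost. -/
def cost (w : Fin n × Fin n → ℝ) (e : ResArc n) : ℝ := if e.fwd then w e.arc else - w e.arc

end ResArc

namespace Network

variable {n : ℕ}

/-- `e` is an arc of the residual graph of `N` with respect to the flow `f`. -/
def InResidual (N : Network n) (f : Fin n × Fin n → ℤ) (e : ResArc n) : Prop :=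
  e.arc ∈ N.A ∧ if e.fwd then f e.arc < N.u e.arc else N.l e.arc < f e.arc

/-- `y` is an optimal node potential for the flow `f` and the arc costs `w`: the reduced costs of
all residual arcs are nonnegative. -/
def IsOptimalPotential (N : Network n) (w : Fin n × Fin n → ℝ) (f : Fin n × Fin n → ℤ)
    (y : Fin n → ℝ) : Prop :=
  ∀ e : ResArc n, N.InResidual f e → 0 ≤ e.cost w + y e.src - y e.dst

open Classical in
/-- The reduced network: the arcs with nonzero reduced cost are removed, and the balances are
adjusted by the flow that `f` sends through the removed arcs. -/
noncomputable def reduced (N : Network n) (w : Fin n × Fin n → ℝ) (y : Fin n → ℝ)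
    (f : Fin n × Fin n → ℤ) : Network n where
  A := N.A.filter fun a => reducedCost w y a = 0
  l := N.l
  u := N.u
  b := fun i => N.b i
    - (∑ a ∈ N.A with reducedCost w y a ≠ 0 ∧ a.1 = i, f a)
    + ∑ a ∈ N.A with reducedCost w y a ≠ 0 ∧ a.2 = i, f a
  l_nonneg := fun a ha => N.l_nonneg a (Finset.mem_filter.mp ha).1

/-- The list `C` of consecutive arcs is a directed cycle, visiting no node twice, in the residual
graph of `N` with respect to `f`. -/
def IsResidualCycle (N : Network n) (f : Fin n × Fin n → ℤ) (C : List (ResArc n)) : Prop :=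
  C ≠ [] ∧ (∀ e ∈ C, N.InResidual f e) ∧
  (C.map ResArc.src).Nodup ∧ C.map ResArc.dst = (C.map ResArc.src).rotate 1

end Network

/-- A cycle is proper if it does not traverse an arc in both directions. -/
def IsProperCycle {n : ℕ} (C : List (ResArc n)) : Prop := ∀ e ∈ C, e.rev ∉ C

/-- Cost of a residual cycle. -/
def cycleCost {n : ℕ} (w : Fin n × Fin n → ℝ) (C : List (ResArc n)) : ℝ :=
  (C.map (ResArc.cost w)).sum

/-- `C` is a minimum cost cycle among the residual cycles of strictly positive cost. -/
def IsMinPositiveCycle {n : ℕ} (N : Network n) (f : Fin n × Fin n → ℤ)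
    (w : Fin n × Fin n → ℝ) (C : List (ResArc n)) : Prop :=
  N.IsResidualCycle f C ∧ 0 < cycleCost w C ∧
  ∀ C', N.IsResidualCycle f C' → 0 < cycleCost w C' → cycleCost w C ≤ cycleCost w C'

/-! ### Random access machine over the reals

Programs are structured programs for a random access machine.  The memory consists of banks of
natural number cells (for node numbers, addresses, counters) and of banks of real cells (for the
numerical data).  Bank names are constants of the program, so that a program uses only finitely
many banks; the address inside a bank may be computed.  Natural numbers can be added, subtracted
and compared; reals can be added, subtracted, multiplied and compared.  Every elementary operation
costs one step. -/

structure RAMState where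
  idx : ℕ → ℕ → ℕ
  num : ℕ → ℕ → ℝ

/-- Natural number (index) expressions. -/
inductive IExp where
  | lit (k : ℕ)
  | read (bank : ℕ) (addr : IExp)
  | add (x y : IExp)
  | sub (x y : IExp)

namespace IExp

def eval (s : RAMState) : IExp → ℕ
  | lit k => k
  | read bank addr => s.idx bank (addr.eval s)
  | add x y => x.eval s + y.eval s
  | sub x y => x.eval s - y.eval s

/-- Number of elementary operations in an evaluation. -/
def steps : IExp → ℕ
  | lit _ => 1
  | read _ addr => addr.steps + 1
  | add x y => x.steps + y.steps + 1
  | sub x y => x.steps + y.steps + 1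

end IExp

/-- Real number expressions. The only constants are integers. -/
inductive NExp where
  | lit (k : ℤ)
  | read (bank : ℕ) (addr : IExp)
  | add (x y : NExp)
  | sub (x y : NExp)
  | mul (x y : NExp)

namespace NExp

noncomputable def eval (s : RAMState) : NExp → ℝ
  | lit k => (k : ℝ)
  | read bank addr => s.num bank (addr.eval s)
  | add x y => x.eval s + y.eval s
  | sub x y => x.eval s - y.eval s
  | mul x y => x.eval s * y.eval s

def steps : NExp → ℕ
  | lit _ => 1
  | read _ addr => addr.steps + 1
  | add x y => x.steps + y.steps + 1
  | sub x y => x.steps + y.steps + 1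
  | mul x y => x.steps + y.steps + 1

end NExp

/-- Tests. -/
inductive Test where
  | ile (x y : IExp)
  | nle (x y : NExp)
  | neg (t : Test)
  | conj (t t' : Test)

namespace Test

def holds (s : RAMState) : Test → Prop
  | ile x y => x.eval s ≤ y.eval s
  | nle x y => x.eval s ≤ y.eval s
  | neg t => ¬ t.holds s
  | conj t t' => t.holds s ∧ t'.holds s

def steps : Test → ℕ
  | ile x y => x.steps + y.steps + 1
  | nle x y => x.steps + y.steps + 1
  | neg t => t.steps + 1
  | conj t t' => t.steps + t'.steps + 1

end Test

inductive Cmd where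
  | skip
  | setI (bank : ℕ) (addr val : IExp)
  | setN (bank : ℕ) (addr : IExp) (val : NExp)
  | seq (p q : Cmd)
  | cond (t : Test) (p q : Cmd)
  | loop (t : Test) (p : Cmd)

namespace RAMState

def writeI (s : RAMState) (bank addr val : ℕ) : RAMState :=
  { s with idx := Function.update s.idx bank (Function.update (s.idx bank) addr val) }

noncomputable def writeN (s : RAMState) (bank addr : ℕ) (val : ℝ) : RAMState :=
  { s with num := Function.update s.num bank (Function.update (s.num bank) addr val) }

end RAMState

/-- `Exec p s k s'`: started in the state `s`, the program `p` halts after exactly `k` steps in the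
state `s'`. (`loop t p` repeats `p` as long as `t` holds.) -/
inductive Exec : Cmd → RAMState → ℕ → RAMState → Prop where
  | skip (s : RAMState) : Exec Cmd.skip s 1 s
  | setI (s : RAMState) (bank : ℕ) (addr val : IExp) :
      Exec (Cmd.setI bank addr val) s (addr.steps + val.steps + 1)
        (s.writeI bank (addr.eval s) (val.eval s))
  | setN (s : RAMState) (bank : ℕ) (addr : IExp) (val : NExp) :
      Exec (Cmd.setN bank addr val) s (addr.steps + val.steps + 1)
        (s.writeN bank (addr.eval s) (val.eval s))
  | seq {p q : Cmd} {s s₁ s₂ : RAMState} {k₁ k₂ : ℕ} :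
      Exec p s k₁ s₁ → Exec q s₁ k₂ s₂ → Exec (Cmd.seq p q) s (k₁ + k₂) s₂
  | cond_true {t : Test} {p q : Cmd} {s s₁ : RAMState} {k : ℕ} :
      t.holds s → Exec p s k s₁ → Exec (Cmd.cond t p q) s (t.steps + 1 + k) s₁
  | cond_false {t : Test} {p q : Cmd} {s s₁ : RAMState} {k : ℕ} :
      ¬ t.holds s → Exec q s k s₁ → Exec (Cmd.cond t p q) s (t.steps + 1 + k) s₁
  | loop_false {t : Test} {p : Cmd} {s : RAMState} :
      ¬ t.holds s → Exec (Cmd.loop t p) s (t.steps + 1) s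
  | loop_true {t : Test} {p : Cmd} {s s₁ s₂ : RAMState} {k₁ k₂ : ℕ} :
      t.holds s → Exec p s k₁ s₁ → Exec (Cmd.loop t p) s₁ k₂ s₂ →
      Exec (Cmd.loop t p) s (t.steps + 1 + k₁ + k₂) s₂

/-! ### Input and output -/

/-- The `n × n` matrix `g`, stored row by row: `g (i, j)` stands in cell `n * i + j`, all further
cells are `0`. -/
def matrixCells {α : Type*} [Zero α] {n : ℕ} (g : Fin n × Fin n → α) (k : ℕ) : α :=
  if h : k < n * n then g (finProdFinEquiv.symm ⟨k, h⟩) else 0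

/-- Arc data as a matrix, with `0` in the places where there is no arc. -/
noncomputable def arcCells {n : ℕ} (A : Finset (Fin n × Fin n)) (g : Fin n × Fin n → ℝ) : ℕ → ℝ :=
  matrixCells fun a => if a ∈ A then g a else 0

/-- The initial memory. Natural number banks: `0` holds `n`, `1` the adjacency matrix. Real banks:
`0` holds the two weights, `1` to `5` the lower capacities, the upper capacities, the flow, and the
first and second arc costs, `6` the balances. All other cells are `0`. -/
noncomputable def inputState {n : ℕ} (N : Network n) (c₁ c₂ : Fin n × Fin n → ℝ) (lam₁ lam₂ : ℝ)
    (f : Fin n × Fin n → ℤ) : RAMState where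
  idx := fun bank k => match bank with
    | 0 => if k = 0 then n else 0
    | 1 => matrixCells (fun a => if a ∈ N.A then 1 else 0) k
    | _ => 0
  num := fun bank k => match bank with
    | 0 => if k = 0 then lam₁ else if k = 1 then lam₂ else 0
    | 1 => arcCells N.A (fun a => (N.l a : ℝ)) k
    | 2 => arcCells N.A (fun a => (N.u a : ℝ)) k
    | 3 => arcCells N.A (fun a => (f a : ℝ)) k
    | 4 => arcCells N.A c₁ k
    | 5 => arcCells N.A c₂ k
    | 6 => if h : k < n then (N.b ⟨k, h⟩ : ℝ) else 0
    | _ => 0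

/-- The memory `s` holds the arc list `C` as output: its length in bank `2`, and, for its `k`-th
arc, the two ends of the underlying network arc in banks `3` and `4` and the direction in which it
is traversed (`1` forwards, `0` backwards) in bank `5`. -/
def IsOutput {n : ℕ} (s : RAMState) (C : List (ResArc n)) : Prop :=
  s.idx 2 0 = C.length ∧
  ∀ (k : ℕ) (h : k < C.length),
    s.idx 3 k = (C[k].arc.1 : ℕ) ∧ s.idx 4 k = (C[k].arc.2 : ℕ) ∧
    s.idx 5 k = if C[k].fwd then 1 else 0

/-! ### Reasoning about programs -/

/-! The potential `y` is not needed to recognise the cycles of the reduced network. Around a closed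
walk the potentials telescope, so the `w`-cost is the sum of the reduced costs. These are
nonnegative on residual arcs, hence a closed walk in the residual graph of `N` lies in the reduced
network exactly when its `w`-cost is `0` (`inResidual_reduced_of_cost`,
`cycleCost_eq_zero_of_reduced`).

Every potential residual arc therefore gets the lexicographic cost (level, `w`, `c₁`, 1), where the
level is `1` for arcs missing in the residual graph and `0` otherwise. All closed walks then have
nonnegative cost (`resCost_closed_nonneg`): if the level vanishes, the potential gives `w ≥ 0`; if
the `w`-cost vanishes too, the walk lies in the reduced network, where optimality of the flow gives
`c₁ ≥ 0`. So the Floyd-Warshall method computes shortest distances `d` in cubic time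
(`IsPartialDist.pass`), and all of them are finite.

The closing cost of an arc `e` is its cost plus `d` from its head back to its tail. A cycle `C` of
positive cost in the reduced network contains an arc whose closing cost has level `0`, primary part
`0` and secondary part in `(0, c₁(C)]` (`exists_candidate_of_cycle`). The upper bound holds because
`C` itself closes each of its arcs. If all secondary parts were `0`, their sum would be `0`; but the
return distances together lead once around `C` backwards and sum to at least `0`, so that sum is at
least `c₁(C) > 0`.

Conversely, take an arc with the smallest positive secondary closing cost and close it by a shortest
path. The fourth coordinate makes the path simple even though cycles of cost zero exist: the number
of remaining arcs drops with each arc of the path (`IsTrace.snoc`). The resulting cycle is optimal,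
and it is proper because a cycle that uses an arc in both directions consists of these two
traversals and costs `0` (`cycleCost_eq_zero_of_rev_mem`). -/

namespace Cmd

/-- Does the program contain a write to the index bank `b`? -/
def writesI (b : ℕ) : Cmd → Bool
  | skip => false
  | setI bank _ _ => bank == b
  | setN _ _ _ => false
  | seq p q => p.writesI b || q.writesI b
  | cond _ p q => p.writesI b || q.writesI b
  | loop _ p => p.writesI b

/-- Does the program contain a write to the number bank `b`? -/
def writesN (b : ℕ) : Cmd → Bool
  | skip => false
  | setI _ _ _ => false
  | setN bank _ _ => bank == b
  | seq p q => p.writesN b || q.writesN b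
  | cond _ p q => p.writesN b || q.writesN b
  | loop _ p => p.writesN b

def loopFree : Cmd → Bool
  | skip => true
  | setI _ _ _ => true
  | setN _ _ _ => true
  | seq p q => p.loopFree && q.loopFree
  | cond _ p q => p.loopFree && q.loopFree
  | loop _ _ => false

/-- Bound for the number of steps of a loop-free program. -/
def bound : Cmd → ℕ
  | skip => 1
  | setI _ a v => a.steps + v.steps + 1
  | setN _ a v => a.steps + v.steps + 1
  | seq p q => p.bound + q.bound
  | cond t p q => t.steps + 1 + (p.bound + q.bound)
  | loop _ _ => 0

open Classical in
/-- Result of a loop-free program. -/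
noncomputable def run : Cmd → RAMState → RAMState
  | skip, s => s
  | setI b a v, s => s.writeI b (a.eval s) (v.eval s)
  | setN b a v, s => s.writeN b (a.eval s) (v.eval s)
  | seq p q, s => q.run (p.run s)
  | cond t p q, s => if t.holds s then p.run s else q.run s
  | loop _ _, s => s

theorem exec_run {p : Cmd} (hp : p.loopFree = true) (s : RAMState) :
    ∃ k ≤ p.bound, Exec p s k (p.run s) := by
  induction p generalizing s with
  | skip => exact ⟨_, le_rfl, Exec.skip s⟩
  | setI b a v => exact ⟨_, le_rfl, Exec.setI s b a v⟩
  | setN b a v => exact ⟨_, le_rfl, Exec.setN s b a v⟩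
  | seq p q ihp ihq =>
    simp only [loopFree, Bool.and_eq_true] at hp
    obtain ⟨k, hk, h⟩ := ihp hp.1 s
    obtain ⟨k', hk', h'⟩ := ihq hp.2 (p.run s)
    exact ⟨_, add_le_add hk hk', Exec.seq h h'⟩
  | cond t p q ihp ihq =>
    simp only [loopFree, Bool.and_eq_true] at hp
    by_cases ht : t.holds s
    · obtain ⟨k, hk, h⟩ := ihp hp.1 s
      refine ⟨_, ?_, by simpa [run, ht] using Exec.cond_true ht h⟩
      simp only [bound]; omega
    · obtain ⟨k, hk, h⟩ := ihq hp.2 s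
      refine ⟨_, ?_, by simpa [run, ht] using Exec.cond_false ht h⟩
      simp only [bound]; omega
  | loop t p => simp [loopFree] at hp

end Cmd

namespace RAMState

@[simp] theorem writeI_num (s : RAMState) (b a v : ℕ) : (s.writeI b a v).num = s.num := rfl

@[simp] theorem writeN_idx (s : RAMState) (b a : ℕ) (v : ℝ) : (s.writeN b a v).idx = s.idx := rfl

theorem writeI_idx (s : RAMState) (b a v b' a' : ℕ) :
    (s.writeI b a v).idx b' a' = if b' = b ∧ a' = a then v else s.idx b' a' := by
  by_cases h : b' = b
  · subst h; simp [writeI, Function.update_apply]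
  · simp [writeI, h]

theorem writeN_num (s : RAMState) (b a : ℕ) (v : ℝ) (b' a' : ℕ) :
    (s.writeN b a v).num b' a' = if b' = b ∧ a' = a then v else s.num b' a' := by
  by_cases h : b' = b
  · subst h; simp [writeN, Function.update_apply]
  · simp [writeN, h]

/-- `s'` agrees with `s` in the banks that `p` does not write to. -/
def SameOff (p : Cmd) (s s' : RAMState) : Prop :=
  (∀ b, p.writesI b = false → s'.idx b = s.idx b) ∧
  ∀ b, p.writesN b = false → s'.num b = s.num b

theorem SameOff.refl (p : Cmd) (s : RAMState) : SameOff p s s := ⟨fun _ _ => rfl, fun _ _ => rfl⟩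

theorem SameOff.trans {p : Cmd} {s s' s'' : RAMState} (h : SameOff p s s')
    (h' : SameOff p s' s'') : SameOff p s s'' :=
  ⟨fun b hb => (h'.1 b hb).trans (h.1 b hb), fun b hb => (h'.2 b hb).trans (h.2 b hb)⟩

end RAMState

open RAMState

/-- The frame rule. The written banks are read off the syntax, so for a concrete program the
preservation of a bank is settled by `rfl`. -/
theorem Exec.sameOff {p : Cmd} {s s' : RAMState} {k : ℕ} (h : Exec p s k s') :
    SameOff p s s' := by
  induction h with
  | skip s => exact .refl _ _
  | setI s b a v =>
    refine ⟨fun b' hb => ?_, fun _ _ => rfl⟩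
    have : b' ≠ b := by rintro rfl; simp [Cmd.writesI] at hb
    simp [writeI, this]
  | setN s b a v =>
    refine ⟨fun _ _ => rfl, fun b' hb => ?_⟩
    have : b' ≠ b := by rintro rfl; simp [Cmd.writesN] at hb
    simp [writeN, this]
  | seq _ _ ih ih' =>
    constructor
    · intro b hb
      simp only [Cmd.writesI, Bool.or_eq_false_iff] at hb
      exact (ih'.1 b hb.2).trans (ih.1 b hb.1)
    · intro b hb
      simp only [Cmd.writesN, Bool.or_eq_false_iff] at hb
      exact (ih'.2 b hb.2).trans (ih.2 b hb.1)
  | cond_true _ _ ih =>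
    constructor
    · intro b hb
      simp only [Cmd.writesI, Bool.or_eq_false_iff] at hb
      exact ih.1 b hb.1
    · intro b hb
      simp only [Cmd.writesN, Bool.or_eq_false_iff] at hb
      exact ih.2 b hb.1
  | cond_false _ _ ih =>
    constructor
    · intro b hb
      simp only [Cmd.writesI, Bool.or_eq_false_iff] at hb
      exact ih.1 b hb.2
    · intro b hb
      simp only [Cmd.writesN, Bool.or_eq_false_iff] at hb
      exact ih.2 b hb.2
  | loop_false _ => exact .refl _ _
  | loop_true _ _ _ ih ih' =>
    exact ⟨fun b hb => (ih'.1 b hb).trans (ih.1 b hb),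
      fun b hb => (ih'.2 b hb).trans (ih.2 b hb)⟩

/-- Started in `s`, the program `p` halts after at most `T` steps in a state that satisfies `Q`. -/
def Halts (p : Cmd) (s : RAMState) (T : ℕ) (Q : RAMState → Prop) : Prop :=
  ∃ k s', Exec p s k s' ∧ k ≤ T ∧ Q s'

namespace Halts

variable {p q : Cmd} {s : RAMState} {T T' : ℕ} {Q Q' : RAMState → Prop}

theorem mono (h : Halts p s T Q) (hT : T ≤ T') (hQ : ∀ s', SameOff p s s' → Q s' → Q' s') :
    Halts p s T' Q' := by
  obtain ⟨k, s', he, hk, h⟩ := h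
  exact ⟨k, s', he, hk.trans hT, hQ _ he.sameOff h⟩

theorem of_run (hp : p.loopFree = true) (h : Q (p.run s)) : Halts p s p.bound Q := by
  obtain ⟨k, hk, he⟩ := Cmd.exec_run hp s
  exact ⟨k, _, he, hk, h⟩

theorem seq (h : Halts p s T Q) (h' : ∀ s', SameOff p s s' → Q s' → Halts q s' T' Q') :
    Halts (Cmd.seq p q) s (T + T') Q' := by
  obtain ⟨k, s₁, he, hk, h⟩ := h
  obtain ⟨k', s₂, he', hk', h''⟩ := h' s₁ he.sameOff h
  exact ⟨_, s₂, Exec.seq he he', add_le_add hk hk', h''⟩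

theorem cond {t : Test} (h : t.holds s → Halts p s T Q) (h' : ¬ t.holds s → Halts q s T' Q) :
    Halts (Cmd.cond t p q) s (t.steps + 1 + (T + T')) Q := by
  by_cases ht : t.holds s
  · obtain ⟨k, s', he, hk, hQ⟩ := h ht
    exact ⟨_, s', Exec.cond_true ht he, by omega, hQ⟩
  · obtain ⟨k, s', he, hk, hQ⟩ := h' ht
    exact ⟨_, s', Exec.cond_false ht he, by omega, hQ⟩

end Halts

/-! ### Counting loops -/

/-- The variable `v`: cell `0` of the index bank `v`. -/
def IExp.var (v : ℕ) : IExp := .read v (.lit 0)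

@[simp] theorem IExp.eval_var (s : RAMState) (v : ℕ) : (IExp.var v).eval s = s.idx v 0 := rfl

/-- Repeat `body` for the values `0, …, n - 1` of the variable `v`, where `n` is the value of the
variable `0`. -/
def forLoop (v : ℕ) (body : Cmd) : Cmd :=
  .seq (.setI v (.lit 0) (.lit 0)) (.loop (.neg (.ile (.var 0) (.var v)))
    (.seq body (.setI v (.lit 0) (.add (.var v) (.lit 1)))))

theorem forLoop_halts {v : ℕ} {body : Cmd} {n T : ℕ} {s₀ : RAMState} (hn : s₀.idx 0 0 = n)
    (hpos : 0 < n) (hv : body.writesI v = false) (h0 : body.writesI 0 = false) (hv0 : v ≠ 0)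
    (I : ℕ → RAMState → Prop) (hI : ∀ k s x, I k s → I k (s.writeI v 0 x)) (h : I 0 s₀)
    (step : ∀ k < n, ∀ s, SameOff (forLoop v body) s₀ s → s.idx v 0 = k → I k s →
      Halts body s T (I (k + 1))) :
    Halts (forLoop v body) s₀ ((T + 23) * n) (I n) := by
  set B : Cmd := .loop (.neg (.ile (.var 0) (.var v)))
    (.seq body (.setI v (.lit 0) (.add (.var v) (.lit 1)))) with hB
  have hw : ∀ s x, SameOff (forLoop v body) s (s.writeI v 0 x) := by
    intro s x
    refine ⟨fun b hb => ?_, fun _ _ => rfl⟩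
    have : b ≠ v := by rintro rfl; simp [Cmd.writesI, forLoop] at hb
    simp [writeI, this]
  have hbody : ∀ s s', SameOff body s s' → SameOff (forLoop v body) s s' := by
    refine fun s s' hs => ⟨fun b hb => hs.1 b ?_, fun b hb => hs.2 b ?_⟩
    · simp [Cmd.writesI, forLoop] at hb; exact hb.2.1
    · simpa [Cmd.writesN, forLoop] using hb
  have h0' : (forLoop v body).writesI 0 = false := by
    simp [Cmd.writesI, forLoop, h0, hv0]
  -- Each round costs 7 steps for the test, at most `T` for the body and 6 for the increment; the
  -- final failing test costs 7. With 3 steps for the initialisation the total is at most `(T + 13)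
  -- * n + 10`, and this is at most `(T + 23) * n` because `n` is positive.
  have key : ∀ m k, k + m = n → ∀ s, SameOff (forLoop v body) s₀ s → s.idx v 0 = k → I k s →
      Halts B s ((T + 13) * m + 7) (I n) := by
    intro m
    induction m with
    | zero =>
      intro k hk s hs hsv hIk
      have hk' : k = n := by omega
      have hn' : s.idx 0 0 = n := by rw [hs.1 0 h0', hn]
      refine ⟨_, s, Exec.loop_false ?_, ?_, hk' ▸ hIk⟩
      · simp [Test.holds, hn', hsv, hk']
      · simp [Test.steps, IExp.steps, IExp.var]
    | succ m ih =>
      intro k hk s hs hsv hIk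
      have hn' : s.idx 0 0 = n := by rw [hs.1 0 h0', hn]
      obtain ⟨k₁, s₁, he, hk₁, hI₁⟩ := step k (by omega) s hs hsv hIk
      have hv₁ : s₁.idx v 0 = k := by rw [he.sameOff.1 v hv, hsv]
      obtain ⟨k₂, s₂, he₂, hk₂, hI₂⟩ := ih (k + 1) (by omega) (s₁.writeI v 0 (k + 1))
        ((hs.trans (hbody _ _ he.sameOff)).trans (hw _ _)) (by simp [writeI_idx]) (hI _ _ _ hI₁)
      have hset := Exec.setI s₁ v (.lit 0) (.add (.var v) (.lit 1))
      simp only [IExp.eval, IExp.eval_var, hv₁] at hset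
      refine ⟨_, s₂, Exec.loop_true ?_ (Exec.seq he hset) he₂, ?_, hI₂⟩
      · simp [Test.holds, hn', hsv]; omega
      · simp [Test.steps, IExp.steps, IExp.var]
        nlinarith
  obtain ⟨k, s', he, hk, hI'⟩ := key n 0 (by omega) (s₀.writeI v 0 0) (hw _ _)
    (by simp [writeI_idx]) (hI _ _ _ h)
  refine ⟨_, s', Exec.seq (Exec.setI s₀ v (.lit 0) (.lit 0)) he, ?_, hI'⟩
  simp [IExp.steps]
  nlinarith

/-- Run through all pairs of values of the variables `20` and `21`. -/
def forPairs (body : Cmd) : Cmd := forLoop 20 (forLoop 21 body)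

/-- Indexing the invariant by the set of processed pairs hides the order of the traversal. That the
current pair is new is what an in-place update of a matrix needs. -/
theorem forPairs_halts {body : Cmd} {n T : ℕ} {s₀ : RAMState} (hn : s₀.idx 0 0 = n)
    (hpos : 0 < n) (h20 : body.writesI 20 = false) (h21 : body.writesI 21 = false)
    (h0 : body.writesI 0 = false)
    (I : Set (Fin n × Fin n) → RAMState → Prop)
    (hI20 : ∀ S s x, I S s → I S (s.writeI 20 0 x))
    (hI21 : ∀ S s x, I S s → I S (s.writeI 21 0 x)) (h : I ∅ s₀)
    (step : ∀ (i j : Fin n) S s, (i, j) ∉ S → SameOff (forPairs body) s₀ s → s.idx 20 0 = i →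
      s.idx 21 0 = j → I S s → Halts body s T (I (insert (i, j) S))) :
    Halts (forPairs body) s₀ (((T + 23) * n + 23) * n) (I Set.univ) := by
  have h0' : (forLoop 21 body).writesI 0 = false := by simp [Cmd.writesI, forLoop, h0]
  have h20' : (forLoop 21 body).writesI 20 = false := by simp [Cmd.writesI, forLoop, h20]
  have hsub : ∀ s s', SameOff (forLoop 21 body) s s' → SameOff (forPairs body) s s' := by
    refine fun s s' hs => ⟨fun b hb => hs.1 b ?_, fun b hb => hs.2 b ?_⟩
    · simp only [forPairs] at hb
      rw [forLoop] at hb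
      simp [Cmd.writesI] at hb; exact hb.2.1
    · simp only [forPairs] at hb
      rw [forLoop] at hb
      simpa [Cmd.writesN] using hb
  refine (forLoop_halts hn hpos h20' h0' (by norm_num)
    (fun i s => I {p | (p.1 : ℕ) < i} s) (fun _ _ _ => hI20 _ _ _) (by simpa using h)
    ?_).mono le_rfl fun s' _ hs' => ?_
  · intro i hi s hs hsi hIs
    have hn' : s.idx 0 0 = n := by
      rw [hs.1 0 (by simp [Cmd.writesI, forLoop, h0]), hn]
    refine (forLoop_halts hn' hpos h21 h0 (by norm_num)
      (fun j s => I {p | (p.1 : ℕ) < i ∨ (p.1 : ℕ) = i ∧ (p.2 : ℕ) < j} s)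
      (fun _ _ _ => hI21 _ _ _) (by simpa using hIs) ?_).mono le_rfl fun s' _ hs' => ?_
    · intro j hj s' hs' hsj hIs'
      have := step ⟨i, hi⟩ ⟨j, hj⟩ _ s' (by simp) (hs.trans (hsub _ _ hs'))
        (by rw [hs'.1 20 h20', hsi]) hsj hIs'
      refine this.mono le_rfl fun s'' _ hs'' => ?_
      convert hs'' using 1
      ext ⟨a, b⟩
      simp only [Set.mem_ofPred_eq, Set.mem_insert_iff, Prod.mk.injEq, Fin.ext_iff]
      omega
    · convert hs' using 1
      ext ⟨a, b⟩
      have := b.2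
      simp only [Set.mem_ofPred_eq]
      omega
  · convert hs' using 1
    ext ⟨a, b⟩
    simp

/-! ### Walks and shortest distances -/

section Walks

variable {n : ℕ}

/-- The arcs in `L` form a walk from `i` to `j`. -/
def IsWalk (i j : Fin n) (L : List (ResArc n)) : Prop :=
  i :: L.map ResArc.dst = L.map ResArc.src ++ [j]

@[simp] theorem isWalk_nil {i j : Fin n} : IsWalk i j [] ↔ i = j := by simp [IsWalk]

@[simp] theorem isWalk_cons {i j : Fin n} {e : ResArc n} {L : List (ResArc n)} :
    IsWalk i j (e :: L) ↔ i = e.src ∧ IsWalk e.dst j L := by simp [IsWalk]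

theorem isWalk_append {i j : Fin n} {L M : List (ResArc n)} :
    IsWalk i j (L ++ M) ↔ ∃ k, IsWalk i k L ∧ IsWalk k j M := by
  induction L generalizing i with
  | nil => simp
  | cons e L ih => simp [ih, and_assoc]

theorem isWalk_of_rotate {e : ResArc n} {L : List (ResArc n)}
    (h : (e :: L).map ResArc.dst = ((e :: L).map ResArc.src).rotate 1) :
    IsWalk e.src e.src (e :: L) := by
  simp only [IsWalk, h]; simp

theorem rotate_of_isWalk {e : ResArc n} {L : List (ResArc n)}
    (h : IsWalk e.src e.src (e :: L)) :
    (e :: L).map ResArc.dst = ((e :: L).map ResArc.src).rotate 1 := by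
  simp only [IsWalk] at h
  simp at h ⊢
  exact h

/-- Walks are at least as expensive as paths if cycles have nonnegative costs. -/
theorem exists_path_of_walk {G : Type*} [AddCommGroup G] [LinearOrder G] [IsOrderedAddMonoid G]
    (κ : ResArc n → G) (P : ResArc n → Prop)
    (hcyc : ∀ e L, (∀ e' ∈ e :: L, P e') → ((e :: L).map ResArc.src).Nodup →
      IsWalk e.src e.src (e :: L) → 0 ≤ ((e :: L).map κ).sum)
    {i j : Fin n} (L : List (ResArc n)) (hP : ∀ e ∈ L, P e) (h : IsWalk i j L) :
    ∃ M, (∀ e ∈ M, P e) ∧ IsWalk i j M ∧ (M.map ResArc.src).Nodup ∧ j ∉ M.map ResArc.src ∧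
      (M.map κ).sum ≤ (L.map κ).sum := by
  induction L generalizing i with
  | nil => exact ⟨[], by simp, h, by simp, by simp, le_rfl⟩
  | cons e L ih =>
    obtain ⟨rfl, h'⟩ := isWalk_cons.1 h
    obtain ⟨M, hM, hw, hnd, hj, hc⟩ := ih (fun e' he' => hP e' (by simp [he'])) h'
    have hPe : P e := hP e (by simp)
    simp only [List.map_cons, List.sum_cons]
    -- If the path already visits the source of `e`, then `e` and the part of the path up to that
    -- visit form a simple cycle; dropping it does not increase the cost.
    by_cases hi : e.src ∈ M.map ResArc.src
    · obtain ⟨f, hf, hfe⟩ := List.mem_map.1 hi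
      obtain ⟨M₁, M₂, rfl⟩ := List.append_of_mem hf
      obtain ⟨k, hw₁, hw₂⟩ := isWalk_append.1 hw
      have hk := (isWalk_cons.1 hw₂).1
      have hcy := hcyc e M₁ (by
          intro e' he'
          rcases List.mem_cons.1 he' with rfl | he'
          · exact hPe
          · exact hM e' (by simp [he'])) (by
          simp only [List.map_append, List.map_cons, List.nodup_append] at hnd
          simp only [List.map_cons, List.nodup_cons]
          exact ⟨fun hh => hnd.2.2 _ hh f.src (by simp) hfe.symm, hnd.1⟩) (by
          rw [isWalk_cons]
          refine ⟨rfl, ?_⟩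
          rw [← hfe, ← hk]; exact hw₁)
      refine ⟨f :: M₂, fun e' he' => hM e' (by
        rw [List.mem_append]; exact Or.inr he'), by rw [← hfe, ← hk]; exact hw₂, ?_, ?_, ?_⟩
      · rw [List.map_append, List.nodup_append] at hnd; exact hnd.2.1
      · intro hh; apply hj; rw [List.map_append, List.mem_append]; exact Or.inr hh
      · simp only [List.map_cons, List.sum_cons, List.map_append, List.sum_append] at hcy hc ⊢
        calc κ f + (M₂.map κ).sum ≤ (κ e + (M₁.map κ).sum) + (κ f + (M₂.map κ).sum) :=
              le_add_of_nonneg_left hcy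
          _ = κ e + ((M₁.map κ).sum + (κ f + (M₂.map κ).sum)) := by rw [add_assoc]
          _ ≤ _ := by gcongr
    -- Here the whole walk closes up to a simple cycle, and the empty path is at least as cheap.
    · by_cases hij : e.src = j
      · subst hij
        refine ⟨[], by simp, by simp, by simp, by simp, ?_⟩
        have := hcyc e M (by
          intro e' he'
          rcases List.mem_cons.1 he' with rfl | he'
          · exact hPe
          · exact hM e' he') (by simp only [List.map_cons, List.nodup_cons]; exact ⟨hi, hnd⟩)
          (by rw [isWalk_cons]; exact ⟨rfl, hw⟩)
        simp only [List.map_cons, List.sum_cons] at this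
        simp only [List.map_nil, List.sum_nil]
        exact this.trans (by gcongr)
      · refine ⟨e :: M, ?_, by rw [isWalk_cons]; exact ⟨rfl, hw⟩, ?_, ?_, ?_⟩
        · intro e' he'
          rcases List.mem_cons.1 he' with rfl | he'
          · exact hPe
          · exact hM e' he'
        · simp only [List.map_cons, List.nodup_cons]; exact ⟨hi, hnd⟩
        · simp only [List.map_cons, List.mem_cons, not_or]; exact ⟨fun h => hij h.symm, hj⟩
        · simp only [List.map_cons, List.sum_cons]; gcongr

/-- A path that avoids its end among its sources can only be empty if it starts at that end, so the
reduction to a path compares the walk with cost `0`. -/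
theorem closed_walk_nonneg {G : Type*} [AddCommGroup G] [LinearOrder G] [IsOrderedAddMonoid G]
    (κ : ResArc n → G) (P : ResArc n → Prop)
    (hcyc : ∀ e L, (∀ e' ∈ e :: L, P e') → ((e :: L).map ResArc.src).Nodup →
      IsWalk e.src e.src (e :: L) → 0 ≤ ((e :: L).map κ).sum)
    {i : Fin n} (L : List (ResArc n)) (hP : ∀ e ∈ L, P e) (h : IsWalk i i L) :
    0 ≤ (L.map κ).sum := by
  obtain ⟨M, -, hw, -, hi, hc⟩ := exists_path_of_walk κ P hcyc L hP h
  cases M with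
  | nil => simpa using hc
  | cons e M => simp [(isWalk_cons.1 hw).1] at hi

/-- The distance matrix of the Floyd-Warshall method after the first `m` passes: its entries are
costs of walks, and going through one of the first `m` nodes does not improve them. -/
structure IsPartialDist {G : Type*} [AddCommGroup G] [LinearOrder G] (κ : ResArc n → G) (m : ℕ)
    (d : Fin n × Fin n → G) : Prop where
  diag : ∀ i, d (i, i) = 0
  arc : ∀ e, e.src ≠ e.dst → d (e.src, e.dst) ≤ κ e
  walk : ∀ i j, ∃ L, IsWalk i j L ∧ (L.map κ).sum = d (i, j)
  triangle : ∀ (i j k : Fin n), (k : ℕ) < m → d (i, j) ≤ d (i, k) + d (k, j)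

/-- One pass of the Floyd-Warshall method. -/
def floydPass {G : Type*} [Add G] [LinearOrder G] (k : Fin n) (d : Fin n × Fin n → G)
    (p : Fin n × Fin n) : G :=
  min (d p) (d (p.1, k) + d (k, p.2))

section

variable {G : Type*} [AddCommGroup G] [LinearOrder G] [IsOrderedAddMonoid G] {κ : ResArc n → G}
  {m : ℕ} {d : Fin n × Fin n → G}

-- Pass `k` changes neither column `k` nor, by the next lemma, row `k`. Hence the matrix can be
-- updated in place: the entries read are the same before and after their own update.
omit [IsOrderedAddMonoid G] in
theorem floydPass_col {k : Fin n} (h : d (k, k) = 0) (i : Fin n) :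
    floydPass k d (i, k) = d (i, k) := by simp [floydPass, h]

omit [IsOrderedAddMonoid G] in
theorem floydPass_row {k : Fin n} (h : d (k, k) = 0) (j : Fin n) :
    floydPass k d (k, j) = d (k, j) := by simp [floydPass, h]

/-- The triangle inequality through an older node `m` is checked according to whether each of the
two new distances uses `k`. A detour through `m` between two visits of `k` is closed and can be
dropped. -/
theorem IsPartialDist.pass (hκ : ∀ i L, IsWalk i i L → 0 ≤ (L.map κ).sum)
    {k : Fin n} (h : IsPartialDist κ k d) : IsPartialDist κ (k + 1) (floydPass k d) := by
  have hclosed : ∀ i j, 0 ≤ d (i, j) + d (j, i) := by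
    intro i j
    obtain ⟨L, hL, hL'⟩ := h.walk i j
    obtain ⟨M, hM, hM'⟩ := h.walk j i
    rw [← hL', ← hM', ← List.sum_append, ← List.map_append]
    exact hκ i _ (isWalk_append.2 ⟨j, hL, hM⟩)
  refine ⟨fun i => ?_, fun e he => (min_le_left _ _).trans (h.arc e he), fun i j => ?_,
    fun i j (m : Fin n) hm => ?_⟩
  · simp [floydPass, h.diag, hclosed]
  · rcases min_choice (d (i, j)) (d (i, k) + d (k, j)) with hc | hc
    · simp only [floydPass, hc]; exact h.walk i j
    · simp only [floydPass, hc]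
      obtain ⟨L, hL, hL'⟩ := h.walk i k
      obtain ⟨M, hM, hM'⟩ := h.walk k j
      exact ⟨L ++ M, isWalk_append.2 ⟨k, hL, hM⟩, by simp [hL', hM']⟩
  · rcases Nat.lt_succ_iff_lt_or_eq.1 hm with hm | hm
    · have t := fun i j => h.triangle i j m hm
      have h1 : floydPass k d (i, j) ≤ d (i, j) := min_le_left _ _
      have h2 : floydPass k d (i, j) ≤ d (i, k) + d (k, j) := min_le_right _ _
      rcases min_choice (d (i, m)) (d (i, k) + d (k, m)) with hc | hc <;>
      rcases min_choice (d (m, j)) (d (m, k) + d (k, j)) with hc' | hc'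
      · calc _ ≤ _ := h1.trans (t i j)
          _ = _ := by simp only [floydPass, hc, hc']
      · calc _ ≤ _ := h2
          _ ≤ (d (i, m) + d (m, k)) + d (k, j) := by gcongr; exact t i k
          _ = _ := by simp only [floydPass, hc, hc', add_assoc]
      · calc _ ≤ _ := h2
          _ ≤ d (i, k) + (d (k, m) + d (m, j)) := by gcongr; exact t k j
          _ = _ := by simp only [floydPass, hc, hc', add_assoc]
      -- Both halves pass through `k`, so the closed walk from `k` to `m` and back is removed.
      · calc _ ≤ _ := h2
          _ ≤ d (i, k) + ((d (k, m) + d (m, k)) + d (k, j)) := by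
            gcongr; exact le_add_of_nonneg_left (hclosed _ _)
          _ = _ := by simp only [floydPass, hc, hc', add_assoc]
    · have hm : m = k := Fin.ext hm
      subst hm
      rw [floydPass_col (h.diag _), floydPass_row (h.diag _)]
      exact min_le_right _ _

-- The field `arc` leaves out loops because the diagonal is kept at `0`; a loop is a closed walk, so
-- its cost is nonnegative anyway.
omit [IsOrderedAddMonoid G] in
theorem IsPartialDist.le_arc (hκ : ∀ i L, IsWalk i i L → 0 ≤ (L.map κ).sum)
    (h : IsPartialDist κ m d) (e : ResArc n) : d (e.src, e.dst) ≤ κ e := by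
  by_cases he : e.src = e.dst
  · rw [← he, h.diag]
    simpa using hκ e.src [e] (by simp [he])
  · exact h.arc e he

theorem IsPartialDist.le_walk (hκ : ∀ i L, IsWalk i i L → 0 ≤ (L.map κ).sum)
    (h : IsPartialDist κ n d) {i j : Fin n} {L : List (ResArc n)} (hL : IsWalk i j L) :
    d (i, j) ≤ (L.map κ).sum := by
  induction L generalizing i with
  | nil => rw [isWalk_nil.1 hL, h.diag]; simp
  | cons e L ih =>
    obtain ⟨rfl, hL₁⟩ := isWalk_cons.1 hL
    simp only [List.map_cons, List.sum_cons]
    exact (h.triangle _ _ _ e.dst.2).trans (add_le_add (h.le_arc hκ e) (ih hL₁))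

/-- A shortest path starts with an arc. -/
theorem IsPartialDist.exists_arc (hκ : ∀ i L, IsWalk i i L → 0 ≤ (L.map κ).sum)
    (h : IsPartialDist κ n d) {i j : Fin n} (hij : i ≠ j) :
    ∃ e : ResArc n, e.src = i ∧ κ e + d (e.dst, j) ≤ d (i, j) := by
  obtain ⟨L, hL, hL'⟩ := h.walk i j
  cases L with
  | nil => exact absurd (isWalk_nil.1 hL) hij
  | cons e L =>
    obtain ⟨rfl, hL₁⟩ := isWalk_cons.1 hL
    refine ⟨e, rfl, ?_⟩
    rw [← hL']
    simp only [List.map_cons, List.sum_cons]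
    gcongr
    exact h.le_walk hκ hL₁

theorem IsPartialDist.le_cons (hκ : ∀ i L, IsWalk i i L → 0 ≤ (L.map κ).sum)
    (h : IsPartialDist κ n d) (e : ResArc n) (j : Fin n) :
    d (e.src, j) ≤ κ e + d (e.dst, j) :=
  (h.triangle _ _ _ e.dst.2).trans (add_le_add_left (h.le_arc hκ e) _)

theorem IsPartialDist.closed_nonneg (hκ : ∀ i L, IsWalk i i L → 0 ≤ (L.map κ).sum)
    (h : IsPartialDist κ n d) (e : ResArc n) : 0 ≤ κ e + d (e.dst, e.src) :=
  (h.diag e.src).symm.le.trans (h.le_cons hκ e e.src)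

/-- The cheapest closed walk through an arc of a closed walk. -/
theorem IsPartialDist.le_closed (hκ : ∀ i L, IsWalk i i L → 0 ≤ (L.map κ).sum)
    (h : IsPartialDist κ n d) {i : Fin n} {L : List (ResArc n)} (hL : IsWalk i i L)
    {e : ResArc n} (he : e ∈ L) : κ e + d (e.dst, e.src) ≤ (L.map κ).sum := by
  obtain ⟨A, B, rfl⟩ := List.append_of_mem he
  obtain ⟨k, hA, hB⟩ := isWalk_append.1 hL
  obtain ⟨rfl, hB₁⟩ := isWalk_cons.1 hB
  have := h.le_walk hκ (isWalk_append.2 ⟨i, hB₁, hA⟩)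
  simp only [List.map_append, List.sum_append, List.map_cons, List.sum_cons] at this ⊢
  calc κ e + d (e.dst, e.src) ≤ κ e + ((B.map κ).sum + (A.map κ).sum) := by gcongr
    _ = _ := by abel

/-- The return trips of the individual arcs, taken in reverse order, lead from `j` to `i`. -/
theorem IsPartialDist.le_sum_back (h : IsPartialDist κ n d) {i j : Fin n} {L : List (ResArc n)}
    (hL : IsWalk i j L) : d (j, i) ≤ (L.map fun e => d (e.dst, e.src)).sum := by
  induction L generalizing i with
  | nil => rw [isWalk_nil.1 hL, h.diag]; simp
  | cons e L ih =>
    obtain ⟨rfl, hL₁⟩ := isWalk_cons.1 hL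
    simp only [List.map_cons, List.sum_cons]
    rw [add_comm]
    exact (h.triangle _ _ e.dst e.dst.2).trans (by gcongr; exact ih hL₁)

/-- On a closed walk the return trips form a closed tour as well, and its cost is at least `d (i, i)
= 0`. This is what forces a positive cycle to contain an arc of nonzero closing cost. -/
theorem IsPartialDist.sum_le_sum_closed (h : IsPartialDist κ n d) {i : Fin n}
    {L : List (ResArc n)} (hL : IsWalk i i L) :
    (L.map κ).sum ≤ (L.map fun e => κ e + d (e.dst, e.src)).sum := by
  rw [List.sum_map_add]
  exact le_add_of_nonneg_right ((h.diag i).symm.le.trans (h.le_sum_back hL))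

end

end Walks

/-! ### Lexicographic costs -/

/-- Quadruples of reals, ordered lexicographically. -/
abbrev LexCost := ℝ ×ₗ ℝ ×ₗ ℝ ×ₗ ℝ

namespace LexCost

def mk (a b c d : ℝ) : LexCost := toLex (a, toLex (b, toLex (c, d)))

/-- The coordinates are additive maps so that they commute with sums along walks. On a walk the
level counts the arcs missing in the residual graph, which replaces infinite costs. -/
def level : LexCost →+ ℝ where
  toFun x := (ofLex x).1
  map_zero' := rfl
  map_add' _ _ := rfl

def primary : LexCost →+ ℝ where
  toFun x := (ofLex (ofLex x).2).1
  map_zero' := rfl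
  map_add' _ _ := rfl

def secondary : LexCost →+ ℝ where
  toFun x := (ofLex (ofLex (ofLex x).2).2).1
  map_zero' := rfl
  map_add' _ _ := rfl

def length : LexCost →+ ℝ where
  toFun x := (ofLex (ofLex (ofLex x).2).2).2
  map_zero' := rfl
  map_add' _ _ := rfl

@[simp] theorem level_mk (a b c d : ℝ) : level (mk a b c d) = a := rfl
@[simp] theorem primary_mk (a b c d : ℝ) : primary (mk a b c d) = b := rfl
@[simp] theorem secondary_mk (a b c d : ℝ) : secondary (mk a b c d) = c := rfl

theorem zero_eq : (0 : LexCost) = mk 0 0 0 0 := rfl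

theorem le_iff (x y : LexCost) : x ≤ y ↔ level x ≤ level y ∧ (level x = level y →
    primary x ≤ primary y ∧ (primary x = primary y →
    secondary x ≤ secondary y ∧ (secondary x = secondary y → length x ≤ length y))) := by
  rw [Prod.Lex.le_iff', Prod.Lex.le_iff', Prod.Lex.le_iff']
  rfl

theorem mk_le_mk (a b c d a' b' c' d' : ℝ) : mk a b c d ≤ mk a' b' c' d' ↔
    a ≤ a' ∧ (a = a' → b ≤ b' ∧ (b = b' → c ≤ c' ∧ (c = c' → d ≤ d'))) := le_iff _ _

end LexCost

/-! ### Residual cycles -/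

section Residual

variable {n : ℕ}

@[simp] theorem ResArc.rev_src (e : ResArc n) : e.rev.src = e.dst := by
  rcases e with ⟨a, _ | _⟩ <;> rfl

@[simp] theorem ResArc.rev_dst (e : ResArc n) : e.rev.dst = e.src := by
  rcases e with ⟨a, _ | _⟩ <;> rfl

@[simp] theorem ResArc.cost_rev (w : Fin n × Fin n → ℝ) (e : ResArc n) :
    e.rev.cost w = - e.cost w := by
  rcases e with ⟨a, _ | _⟩ <;> simp [ResArc.rev, ResArc.cost]

theorem ResArc.rev_ne (e : ResArc n) : e.rev ≠ e := by
  rcases e with ⟨a, _ | _⟩ <;> simp [ResArc.rev]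

/-- The cost of an arc list is the pairing of the weights with its signed incidence vector. It is
applied to the arc costs and, for flow conservation, to the difference of the indicators of tail and
head at a node. -/
theorem sum_counts_mul (A : Finset (Fin n × Fin n)) (φ : Fin n × Fin n → ℝ) [DecidableEq (ResArc n)]
    (C : List (ResArc n)) (h : ∀ e ∈ C, e.arc ∈ A) :
    ∑ a ∈ A, φ a * (((C.count ⟨a, true⟩ : ℤ) - (C.count ⟨a, false⟩ : ℤ) : ℤ) : ℝ) =
      (C.map (ResArc.cost φ)).sum := by
  induction C with
  | nil => simp
  | cons e C ih =>
    have ih := ih fun e' he' => h e' (by simp [he'])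
    have he := h e (by simp)
    rw [List.map_cons, List.sum_cons, ← ih]
    have : e.cost φ = ∑ a ∈ A, if a = e.arc then e.cost φ else 0 := by simp [he]
    rw [this, ← Finset.sum_add_distrib]
    refine Finset.sum_congr rfl fun a _ => ?_
    rcases e with ⟨b, _ | _⟩ <;> by_cases hb : b = a
    · subst hb; simp [ResArc.cost]; ring
    · simp [hb, Ne.symm hb]
    · subst hb; simp [ResArc.cost]; ring
    · simp [hb, Ne.symm hb]

/-- Sending one unit along the cycle gives another feasible flow, whose cost differs by the cost of
the cycle. -/
theorem Network.IsOptimalFlow.cycleCost_nonneg {N : Network n} {c : Fin n × Fin n → ℝ}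
    {f : Fin n × Fin n → ℤ} (hf : N.IsOptimalFlow c f) {C : List (ResArc n)}
    (hC : N.IsResidualCycle f C) : 0 ≤ cycleCost c C := by
  classical
  obtain ⟨-, hres, hnd, hrot⟩ := hC
  have hCnd : C.Nodup := List.Nodup.of_map _ hnd
  have hA : ∀ e ∈ C, e.arc ∈ N.A := fun e he => (hres e he).1
  set χ : Fin n × Fin n → ℤ := fun a => (C.count ⟨a, true⟩ : ℤ) - (C.count ⟨a, false⟩ : ℤ) with hχ
  have hcost : N.cost c (fun a => f a + χ a) = N.cost c f + cycleCost c C := by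
    simp only [Network.cost, cycleCost]
    rw [← sum_counts_mul N.A c C hA, ← Finset.sum_add_distrib]
    refine Finset.sum_congr rfl fun a _ => ?_
    rw [hχ]; push_cast; ring
  have hflow : N.IsFlow (fun a => f a + χ a) := by
    refine ⟨fun a ha => ?_, fun i => ?_⟩
    · have h := hf.1.1 a ha
      -- Distinct sources allow each residual arc at most once, and by integrality a strict capacity
      -- inequality leaves room for one unit. An arc used in both directions keeps its flow.
      have ht : C.count ⟨a, true⟩ ≤ 1 := List.nodup_iff_count_le_one.1 hCnd _
      have hb : C.count ⟨a, false⟩ ≤ 1 := List.nodup_iff_count_le_one.1 hCnd _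
      have ht' : 0 < C.count ⟨a, true⟩ → f a < N.u a := fun hh => by
        simpa using (hres _ (List.count_pos_iff.1 hh)).2
      have hb' : 0 < C.count ⟨a, false⟩ → N.l a < f a := fun hh => by
        simpa using (hres _ (List.count_pos_iff.1 hh)).2
      simp only [hχ]
      omega
    · rw [← hf.1.2 i]
      -- The sources and the targets of a cycle agree up to rotation, so every node is entered as
      -- often as it is left.
      have hzero : (∑ a ∈ N.A with a.1 = i, χ a - ∑ a ∈ N.A with a.2 = i, χ a : ℤ) = 0 := by
        have h := sum_counts_mul N.A
          (fun a => (if a.1 = i then 1 else 0) - (if a.2 = i then 1 else 0)) C hA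
        have h1 : (C.map (ResArc.cost fun a : Fin n × Fin n =>
            ((if a.1 = i then 1 else 0) - (if a.2 = i then 1 else 0) : ℝ))).sum =
            ((C.map ResArc.src).map fun j => if j = i then (1 : ℝ) else 0).sum -
            ((C.map ResArc.dst).map fun j => if j = i then (1 : ℝ) else 0).sum := by
          clear * -
          induction C with
          | nil => simp
          | cons e C ih =>
            simp only [List.map_cons, List.sum_cons, ih]
            rcases e with ⟨b, _ | _⟩ <;> simp [ResArc.cost, ResArc.src, ResArc.dst] <;> ring
        rw [h1, hrot, ((List.rotate_perm (C.map ResArc.src) 1).map _).sum_eq, sub_self] at h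
        rw [Finset.sum_filter, Finset.sum_filter, ← Finset.sum_sub_distrib]
        have : ((∑ a ∈ N.A, ((if a.1 = i then χ a else 0) - if a.2 = i then χ a else 0) : ℤ) : ℝ)
            = 0 := by
          rw [← h]; push_cast
          refine Finset.sum_congr rfl fun a _ => ?_
          simp only [hχ]
          split_ifs <;> push_cast <;> ring
        exact_mod_cast this
      simp only [Finset.sum_add_distrib]
      omega
  have := hf.2 _ hflow
  rw [hcost] at this
  linarith

/-- Rotate the cycle so that it begins with `e`. The next arc and `e.rev` both leave the head of
`e`, hence they coincide because sources are distinct. Then the cycle is already closed, and the two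
costs cancel. -/
theorem cycleCost_eq_zero_of_rev_mem {w : Fin n × Fin n → ℝ} {i : Fin n} {C : List (ResArc n)}
    (hC : IsWalk i i C) (hnd : (C.map ResArc.src).Nodup) {e : ResArc n} (he : e ∈ C)
    (he' : e.rev ∈ C) : cycleCost w C = 0 := by
  obtain ⟨A, B, rfl⟩ := List.append_of_mem he
  obtain ⟨k, hA, hB⟩ := isWalk_append.1 hC
  obtain ⟨rfl, hB₁⟩ := isWalk_cons.1 hB
  have hM := isWalk_append.2 ⟨i, hB₁, hA⟩
  have hperm : (A ++ e :: B).Perm (e :: (B ++ A)) := by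
    refine List.perm_middle.trans (List.Perm.cons _ List.perm_append_comm)
  have hnd' := (hperm.map ResArc.src).nodup_iff.1 hnd
  have hmem : e.rev ∈ B ++ A := by
    have := hperm.mem_iff.1 he'
    simpa [ResArc.rev_ne] using this
  rw [cycleCost, (hperm.map _).sum_eq]
  generalize B ++ A = M at *
  cases M with
  | nil => simp at hmem
  | cons g M =>
    obtain ⟨hg, hM₁⟩ := isWalk_cons.1 hM
    rw [List.map_cons, List.map_cons, List.nodup_cons, List.nodup_cons] at hnd'
    have hge : g = e.rev := by
      rcases List.mem_cons.1 hmem with h | h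
      · exact h.symm
      · exact absurd (List.mem_map.2 ⟨_, h, by simp [hg]⟩) hnd'.2.1
    subst hge
    -- A third arc would leave the source of `e` a second time.
    cases M with
    | nil => simp
    | cons g' M =>
      have := (isWalk_cons.1 hM₁).1
      simp at this
      simp [this] at hnd'

end Residual

/-! ### Cycles of the reduced network -/

section Reduced

variable {n : ℕ} {N : Network n} {w c : Fin n × Fin n → ℝ} {f : Fin n × Fin n → ℤ}
  {y : Fin n → ℝ}

open Classical in
/-- Lexicographic cost of a (potential) residual arc; arcs missing in the residual graph are given
a positive level. -/
noncomputable def resCost (N : Network n) (f : Fin n × Fin n → ℤ) (w c : Fin n × Fin n → ℝ)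
    (e : ResArc n) : LexCost :=
  .mk (if N.InResidual f e then 0 else 1) (e.cost w) (e.cost c) 1

theorem level_sum_resCost_nonneg (L : List (ResArc n)) :
    0 ≤ LexCost.level (L.map (resCost N f w c)).sum := by
  rw [map_list_sum]
  refine List.sum_nonneg fun x hx => ?_
  simp only [List.mem_map] at hx
  obtain ⟨_, ⟨e, -, rfl⟩, rfl⟩ := hx
  simp only [resCost, LexCost.level_mk]
  split_ifs <;> norm_num

theorem level_sum_resCost_eq_zero {L : List (ResArc n)} :
    LexCost.level (L.map (resCost N f w c)).sum = 0 ↔ ∀ e ∈ L, N.InResidual f e := by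
  induction L with
  | nil => simp
  | cons e L ih =>
    have h := level_sum_resCost_nonneg (N := N) (f := f) (w := w) (c := c) L
    simp only [List.map_cons, List.sum_cons, map_add, List.mem_cons, forall_eq_or_imp, ← ih]
    by_cases he : N.InResidual f e
    · simp [resCost, he]
    · have : LexCost.level (resCost N f w c e) = 1 := by simp [resCost, he]
      rw [this]
      simp only [he, false_and, iff_false]
      linarith

theorem primary_sum_resCost (L : List (ResArc n)) :
    LexCost.primary (L.map (resCost N f w c)).sum = cycleCost w L := by
  rw [map_list_sum, List.map_map]; rfl

theorem secondary_sum_resCost (L : List (ResArc n)) :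
    LexCost.secondary (L.map (resCost N f w c)).sum = cycleCost c L := by
  rw [map_list_sum, List.map_map]; rfl

theorem length_sum_resCost (L : List (ResArc n)) :
    LexCost.length (L.map (resCost N f w c)).sum = L.length := by
  rw [map_list_sum, List.map_map]
  have : (LexCost.length ∘ resCost N f w c) = fun _ => (1 : ℝ) := rfl
  simp [this]

/-- The potentials telescope along the walk. -/
theorem cycleCost_eq_sum_reduced (w : Fin n × Fin n → ℝ) (y : Fin n → ℝ) {i j : Fin n}
    {L : List (ResArc n)} (hL : IsWalk i j L) :
    cycleCost w L = (L.map fun e => e.cost w + y e.src - y e.dst).sum - y i + y j := by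
  induction L generalizing i with
  | nil => simp [isWalk_nil.1 hL, cycleCost]
  | cons e L ih =>
    obtain ⟨rfl, hL₁⟩ := isWalk_cons.1 hL
    have := ih hL₁
    simp only [cycleCost, List.map_cons, List.sum_cons] at this ⊢
    rw [this]; ring

theorem Network.IsOptimalPotential.cycleCost_nonneg (hy : N.IsOptimalPotential w f y) {i : Fin n}
    {L : List (ResArc n)} (hL : IsWalk i i L) (hres : ∀ e ∈ L, N.InResidual f e) :
    0 ≤ cycleCost w L := by
  rw [cycleCost_eq_sum_reduced w y hL, sub_add_cancel]
  refine List.sum_nonneg fun x hx => ?_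
  obtain ⟨e, he, rfl⟩ := List.mem_map.1 hx
  exact hy e (hres e he)

theorem reducedCost_eq_zero_iff (w : Fin n × Fin n → ℝ) (y : Fin n → ℝ) (e : ResArc n) :
    Network.reducedCost w y e.arc = 0 ↔ e.cost w + y e.src - y e.dst = 0 := by
  rcases e with ⟨a, _ | _⟩
  · simp only [Network.reducedCost, ResArc.cost, ResArc.src, ResArc.dst]
    constructor <;> intro h <;> simp at * <;> linarith
  · simp [Network.reducedCost, ResArc.cost, ResArc.src, ResArc.dst]

theorem inResidual_reduced {e : ResArc n} : (N.reduced w y f).InResidual f e ↔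
    N.InResidual f e ∧ e.cost w + y e.src - y e.dst = 0 := by
  rw [← reducedCost_eq_zero_iff]
  simp only [Network.InResidual, Network.reduced, Finset.mem_filter]
  tauto

/-- Nonnegative reduced costs with sum `0` all vanish. Thus level `0` and `w`-cost `0` certify that
a closed walk lies in the reduced network, without knowledge of `y`. -/
theorem Network.IsOptimalPotential.inResidual_reduced_of_cost (hy : N.IsOptimalPotential w f y)
    {i : Fin n} {L : List (ResArc n)} (hL : IsWalk i i L) (hres : ∀ e ∈ L, N.InResidual f e)
    (h : cycleCost w L = 0) : ∀ e ∈ L, (N.reduced w y f).InResidual f e := by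
  intro e he
  refine inResidual_reduced.2 ⟨hres e he, ?_⟩
  rw [cycleCost_eq_sum_reduced w y hL, sub_add_cancel] at h
  have h1 : (L.map fun e => e.cost w + y e.src - y e.dst).sum ≥ e.cost w + y e.src - y e.dst := by
    refine List.single_le_sum (fun x hx => ?_) _ (List.mem_map.2 ⟨e, he, rfl⟩)
    obtain ⟨e, he, rfl⟩ := List.mem_map.1 hx
    exact hy e (hres e he)
  exact le_antisymm (h ▸ h1) (hy e (hres e he))

theorem cycleCost_eq_zero_of_reduced {i : Fin n} {L : List (ResArc n)} (hL : IsWalk i i L)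
    (hres : ∀ e ∈ L, (N.reduced w y f).InResidual f e) : cycleCost w L = 0 := by
  rw [cycleCost_eq_sum_reduced w y hL, sub_add_cancel]
  refine List.sum_eq_zero fun x hx => ?_
  obtain ⟨e, he, rfl⟩ := List.mem_map.1 hx
  exact (inResidual_reduced.1 (hres e he)).2

theorem cycleCost_nonneg_of_reduced (hc : (N.reduced w y f).IsOptimalFlow c f) {i : Fin n}
    {L : List (ResArc n)} (hL : IsWalk i i L)
    (hres : ∀ e ∈ L, (N.reduced w y f).InResidual f e) : 0 ≤ cycleCost c L := by
  refine closed_walk_nonneg (ResArc.cost c) ((N.reduced w y f).InResidual f) ?_ L hres hL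
  intro e L hP hnd hw
  exact hc.cycleCost_nonneg ⟨by simp, hP, hnd, rotate_of_isWalk hw⟩

/-- Each coordinate is examined only when the earlier ones vanish, and exactly then the hypothesis
that controls it applies: the potential needs level `0`, and the optimality for `c` needs a walk in
the reduced network. -/
theorem resCost_closed_nonneg (hy : N.IsOptimalPotential w f y)
    (hc : (N.reduced w y f).IsOptimalFlow c f) (i : Fin n) (L : List (ResArc n))
    (hL : IsWalk i i L) : 0 ≤ (L.map (resCost N f w c)).sum := by
  rw [LexCost.le_iff]
  simp only [map_zero]
  refine ⟨level_sum_resCost_nonneg _, fun h => ?_⟩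
  have hres := level_sum_resCost_eq_zero.1 h.symm
  rw [primary_sum_resCost, secondary_sum_resCost, length_sum_resCost]
  refine ⟨hy.cycleCost_nonneg hL hres, fun h => ?_⟩
  have hres' := hy.inResidual_reduced_of_cost hL hres h.symm
  exact ⟨cycleCost_nonneg_of_reduced hc hL hres', fun _ => by positivity⟩

/-- Cost of a cheapest closed walk through the arc `e`, for the distances `d`. -/
noncomputable def closingCost (κ : ResArc n → LexCost) (d : Fin n × Fin n → LexCost)
    (e : ResArc n) : LexCost :=
  κ e + d (e.dst, e.src)

/-- There is a closed walk through `e` of level `0`, of primary cost `0` and of positive secondary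
cost. -/
def IsCandidate (κ : ResArc n → LexCost) (d : Fin n × Fin n → LexCost) (e : ResArc n) : Prop :=
  (closingCost κ d e).level = 0 ∧ (closingCost κ d e).primary = 0 ∧
    0 < (closingCost κ d e).secondary

/-- Averaging over the arcs of `C`: the closing costs sum to at least the cost of `C`, so they
cannot all have secondary part `0`. -/
theorem exists_candidate_of_cycle (hy : N.IsOptimalPotential w f y)
    (hc : (N.reduced w y f).IsOptimalFlow c f) {d : Fin n × Fin n → LexCost}
    (hd : IsPartialDist (resCost N f w c) n d) {C : List (ResArc n)}
    (hC : (N.reduced w y f).IsResidualCycle f C) (hpos : 0 < cycleCost c C) :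
    ∃ e, IsCandidate (resCost N f w c) d e ∧
      (closingCost (resCost N f w c) d e).secondary ≤ cycleCost c C := by
  obtain ⟨hne, hres, -, hrot⟩ := hC
  have hw : ∃ i, IsWalk i i C := by
    cases C with
    | nil => exact absurd rfl hne
    | cons e C => exact ⟨_, isWalk_of_rotate hrot⟩
  obtain ⟨i, hw⟩ := hw
  have hκ := resCost_closed_nonneg hy hc
  have hlev : LexCost.level (C.map (resCost N f w c)).sum = 0 :=
    level_sum_resCost_eq_zero.2 fun e he => (inResidual_reduced.1 (hres e he)).1
  have hpri : LexCost.primary (C.map (resCost N f w c)).sum = 0 := by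
    rw [primary_sum_resCost, cycleCost_eq_zero_of_reduced hw hres]
  -- The closing cost lies lexicographically between `0` and the cost of `C`, which has level and
  -- primary part `0`; this fixes the first two coordinates and bounds the third.
  have hmem : ∀ e ∈ C, (closingCost (resCost N f w c) d e).level = 0 ∧
      (closingCost (resCost N f w c) d e).primary = 0 ∧
      0 ≤ (closingCost (resCost N f w c) d e).secondary ∧
      (closingCost (resCost N f w c) d e).secondary ≤ cycleCost c C := by
    intro e he
    have h1 := (LexCost.le_iff _ _).1 (hd.closed_nonneg hκ e)
    have h2 := (LexCost.le_iff _ _).1 (hd.le_closed hκ hw he)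
    rw [hlev, hpri, secondary_sum_resCost] at h2
    simp only [map_zero] at h1
    simp only [closingCost]
    have l0 := le_antisymm h2.1 h1.1
    have p0 := le_antisymm (h2.2 l0).1 (h1.2 l0.symm).1
    exact ⟨l0, p0, ((h1.2 l0.symm).2 p0.symm).1, ((h2.2 l0).2 p0).1⟩
  by_contra! hno
  have hsec : ∀ e ∈ C, (closingCost (resCost N f w c) d e).secondary = 0 := by
    intro e he
    obtain ⟨h1, h2, h3, h4⟩ := hmem e he
    by_contra h
    exact absurd h4 (not_le.2 (hno e ⟨h1, h2, lt_of_le_of_ne h3 (Ne.symm h)⟩))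
  have hsum := (LexCost.le_iff _ _).1 (hd.sum_le_sum_closed hw)
  have hz : ∀ φ : LexCost →+ ℝ, (∀ e ∈ C, φ (closingCost (resCost N f w c) d e) = 0) →
      φ (C.map fun e => resCost N f w c e + d (e.dst, e.src)).sum = 0 := by
    intro φ hφ
    rw [map_list_sum]
    refine List.sum_eq_zero fun x hx => ?_
    rw [List.map_map] at hx
    obtain ⟨e, he, rfl⟩ := List.mem_map.1 hx
    exact hφ e he
  rw [hlev, hpri, hz _ fun e he => (hmem e he).1, hz _ fun e he => (hmem e he).2.1, hz _ hsec,
    secondary_sum_resCost] at hsum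
  exact absurd ((hsum.2 rfl).2 rfl).1 (not_le.2 hpos)

/-- The closing cost is realised by a simple cycle, and every competitor contains a candidate that
is at most as expensive as the competitor itself. -/
theorem isMinPositiveCycle_of_candidate (hy : N.IsOptimalPotential w f y)
    (hc : (N.reduced w y f).IsOptimalFlow c f) {d : Fin n × Fin n → LexCost}
    (hd : IsPartialDist (resCost N f w c) n d) {e : ResArc n} {L : List (ResArc n)}
    (he : IsCandidate (resCost N f w c) d e)
    (hmin : ∀ e', IsCandidate (resCost N f w c) d e' →
      (closingCost (resCost N f w c) d e).secondary ≤
        (closingCost (resCost N f w c) d e').secondary)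
    (hw : IsWalk e.dst e.src L) (hnd : ((e :: L).map ResArc.src).Nodup)
    (hL : (L.map (resCost N f w c)).sum = d (e.dst, e.src)) :
    IsProperCycle (e :: L) ∧ IsMinPositiveCycle (N.reduced w y f) f c (e :: L) := by
  have hw' : IsWalk e.src e.src (e :: L) := isWalk_cons.2 ⟨rfl, hw⟩
  have hsum : ((e :: L).map (resCost N f w c)).sum = closingCost (resCost N f w c) d e := by
    simp [closingCost, hL]
  obtain ⟨h1, h2, h3⟩ := he
  have hcost : cycleCost c (e :: L) = (closingCost (resCost N f w c) d e).secondary := by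
    rw [← hsum, secondary_sum_resCost]
  rw [← hsum, level_sum_resCost_eq_zero] at h1
  rw [← hsum, primary_sum_resCost] at h2
  refine ⟨fun a ha ha' => ?_, ⟨by simp, hy.inResidual_reduced_of_cost hw' h1 h2, hnd,
    rotate_of_isWalk hw'⟩, hcost ▸ h3, fun C hC hpos => ?_⟩
  · have := cycleCost_eq_zero_of_rev_mem (w := c) hw' hnd ha ha'
    rw [hcost] at this
    exact h3.ne' this
  · obtain ⟨e', he', hle⟩ := exists_candidate_of_cycle hy hc hd hC hpos
    rw [hcost]
    exact (hmin e' he').trans hle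

end Reduced

/-! ### Vector instructions -/

/-- Quadruples of real expressions. -/
structure VExp where
  a : NExp
  b : NExp
  c : NExp
  d : NExp

namespace VExp

noncomputable def eval (s : RAMState) (v : VExp) : LexCost :=
  .mk (v.a.eval s) (v.b.eval s) (v.c.eval s) (v.d.eval s)

def add (v w : VExp) : VExp := ⟨.add v.a w.a, .add v.b w.b, .add v.c w.c, .add v.d w.d⟩

theorem eval_add (s : RAMState) (v w : VExp) : (v.add w).eval s = v.eval s + w.eval s := rfl

def zero : VExp := ⟨.lit 0, .lit 0, .lit 0, .lit 0⟩

theorem eval_zero (s : RAMState) : zero.eval s = 0 := by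
  simp [zero, eval, NExp.eval, LexCost.zero_eq]

/-- Test for `x ≤ y` and, in the case of equality, `t`. -/
def lexTest (x y : NExp) (t : Test) : Test := .conj (.nle x y) (.neg (.conj (.nle y x) (.neg t)))

theorem holds_lexTest (s : RAMState) (x y : NExp) (t : Test) :
    (lexTest x y t).holds s ↔ x.eval s ≤ y.eval s ∧ (x.eval s = y.eval s → t.holds s) := by
  simp only [lexTest, Test.holds, not_and, not_not]
  refine and_congr_right fun h => ⟨fun h' he => h' he.ge, fun h' he => h' (le_antisymm h he)⟩

def leTest (v w : VExp) : Test :=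
  lexTest v.a w.a (lexTest v.b w.b (lexTest v.c w.c (.nle v.d w.d)))

theorem holds_leTest (s : RAMState) (v w : VExp) :
    (leTest v w).holds s ↔ v.eval s ≤ w.eval s := by
  simp only [leTest, holds_lexTest, eval, LexCost.mk_le_mk, Test.holds]

end VExp

/-- The distance matrix, stored in the number banks `12` to `15`. -/
def distExp (addr : IExp) : VExp := ⟨.read 12 addr, .read 13 addr, .read 14 addr, .read 15 addr⟩

noncomputable def distAt (s : RAMState) (k : ℕ) : LexCost :=
  .mk (s.num 12 k) (s.num 13 k) (s.num 14 k) (s.num 15 k)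

theorem eval_distExp (s : RAMState) (addr : IExp) :
    (distExp addr).eval s = distAt s (addr.eval s) := rfl

def storeDist (addr : IExp) (v : VExp) : Cmd :=
  .seq (.setN 12 addr v.a) (.seq (.setN 13 addr v.b) (.seq (.setN 14 addr v.c) (.setN 15 addr v.d)))

theorem IExp.eval_congr {s s' : RAMState} (h : s'.idx = s.idx) (x : IExp) :
    x.eval s' = x.eval s := by
  induction x with
  | lit k => rfl
  | read b a ih => simp [IExp.eval, ih, h]
  | add x y ihx ihy => simp [IExp.eval, ihx, ihy]
  | sub x y ihx ihy => simp [IExp.eval, ihx, ihy]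

theorem IExp.eval_writeN (s : RAMState) (b a : ℕ) (v : ℝ) (x : IExp) :
    x.eval (s.writeN b a v) = x.eval s := IExp.eval_congr (s := s) (s' := s.writeN b a v) rfl x

/-- Does the expression read the number bank `b`? -/
def NExp.reads (b : ℕ) : NExp → Bool
  | lit _ => false
  | read bank _ => bank == b
  | add x y => x.reads b || y.reads b
  | sub x y => x.reads b || y.reads b
  | mul x y => x.reads b || y.reads b

theorem NExp.eval_writeN {b : ℕ} {x : NExp} (h : x.reads b = false) (s : RAMState) (a : ℕ) (v : ℝ) :
    x.eval (s.writeN b a v) = x.eval s := by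
  induction x with
  | lit k => rfl
  | read bank addr =>
    have : bank ≠ b := by rintro rfl; simp [reads] at h
    simp [eval, IExp.eval_writeN, writeN_num, this]
  | add x y ihx ihy =>
    simp only [reads, Bool.or_eq_false_iff] at h; simp [eval, ihx h.1, ihy h.2]
  | sub x y ihx ihy =>
    simp only [reads, Bool.or_eq_false_iff] at h; simp [eval, ihx h.1, ihy h.2]
  | mul x y ihx ihy =>
    simp only [reads, Bool.or_eq_false_iff] at h; simp [eval, ihx h.1, ihy h.2]

/-- The coordinates are written one after the other, so a later coordinate must not read a bank that
has just been overwritten. -/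
theorem distAt_run_storeDist {v : VExp} (addr : IExp)
    (h : (v.b.reads 12 || v.c.reads 12 || v.c.reads 13 || v.d.reads 12 || v.d.reads 13 ||
      v.d.reads 14) = false) (s : RAMState) (k : ℕ) :
    distAt ((storeDist addr v).run s) k = if k = addr.eval s then v.eval s else distAt s k := by
  simp only [Bool.or_eq_false_iff] at h
  obtain ⟨⟨⟨⟨⟨h1, h2⟩, h3⟩, h4⟩, h5⟩, h6⟩ := h
  by_cases hk : k = addr.eval s
  · simp [storeDist, Cmd.run, distAt, writeN_num, IExp.eval_writeN, NExp.eval_writeN, *, VExp.eval]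
  · simp [storeDist, Cmd.run, distAt, writeN_num, IExp.eval_writeN, hk]

/-- The address of the matrix entry in row `i` and column `j`, if index bank `10` holds the
addresses of the beginnings of the rows. -/
def cellExp (i j : IExp) : IExp := .add (.read 10 i) j

def negIf (b : Bool) (x : NExp) : NExp := if b then x else .sub (.lit 0) x

/-- The lexicographic cost of the residual arc given by a network arc and a direction. The levels
are stored in the number banks `10` and `11`. -/
def arcExp (b : Bool) (addr : IExp) : VExp :=
  ⟨.read (if b then 10 else 11) addr,
    negIf b (.add (.mul (.read 0 (.lit 0)) (.read 4 addr)) (.mul (.read 0 (.lit 1)) (.read 5 addr))),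
    negIf b (.read 4 addr), .lit 1⟩

theorem eval_arcExp (s : RAMState) (b : Bool) (addr : IExp) :
    (arcExp b addr).eval s = (arcExp b (.lit (addr.eval s))).eval s := by cases b <;> rfl

theorem cell_injective {n : ℕ} {p q : Fin n × Fin n} :
    n * (p.1 : ℕ) + p.2 = n * (q.1 : ℕ) + q.2 ↔ p = q := by
  have h : ∀ p : Fin n × Fin n, n * (p.1 : ℕ) + p.2 = finProdFinEquiv p := by
    intro p; simp [finProdFinEquiv, add_comm]
  rw [h, h, ← Fin.ext_iff, finProdFinEquiv.injective.eq_iff]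

theorem matrixCells_apply {α : Type*} [Zero α] {n : ℕ} (g : Fin n × Fin n → α)
    (p : Fin n × Fin n) : matrixCells g (n * p.1 + p.2) = g p := by
  have h : n * (p.1 : ℕ) + p.2 = finProdFinEquiv p := by simp [finProdFinEquiv, add_comm]
  rw [matrixCells, dif_pos (h ▸ (finProdFinEquiv p).2)]
  congr 1
  rw [Equiv.symm_apply_eq]
  exact Fin.ext h

/-- The part of the memory that encodes the lexicographic costs `κ` of the residual arcs. -/
structure Ready {n : ℕ} (κ : ResArc n → LexCost) (s : RAMState) : Prop where
  size : s.idx 0 0 = n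
  row : ∀ i : Fin n, s.idx 10 i = n * i
  arc : ∀ b p, (arcExp b (.lit (n * (p : Fin n × Fin n).1 + p.2))).eval s = κ ⟨p, b⟩

/-- The program does not change the encoding of the costs. -/
def Cmd.keepsCosts (p : Cmd) : Bool :=
  !(p.writesI 0 || p.writesI 10 || p.writesN 0 || p.writesN 4 || p.writesN 5 || p.writesN 10 ||
    p.writesN 11)

section

variable {n : ℕ} {κ : ResArc n → LexCost} {s s' : RAMState} {P : Cmd}

theorem Ready.sameOff (h : Ready κ s) (hs : SameOff P s s') (hP : P.keepsCosts = true) :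
    Ready κ s' := by
  simp only [Cmd.keepsCosts, Bool.not_eq_true', Bool.or_eq_false_iff] at hP
  obtain ⟨⟨⟨⟨⟨⟨h0, h10⟩, n0⟩, n4⟩, n5⟩, n10⟩, n11⟩ := hP
  refine ⟨by rw [hs.1 0 h0, h.size], fun i => by rw [hs.1 10 h10, h.row], fun b p => ?_⟩
  rw [← h.arc b p]
  cases b <;> simp [arcExp, VExp.eval, NExp.eval, negIf, IExp.eval, hs.2 0 n0, hs.2 4 n4,
    hs.2 5 n5, hs.2 10 n10, hs.2 11 n11]

theorem Ready.eval_cellExp (h : Ready κ s) {x y : IExp} {i j : Fin n} (hx : x.eval s = i)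
    (hy : y.eval s = j) : (cellExp x y).eval s = n * i + j := by
  simp [cellExp, IExp.eval, hx, hy, h.row]

theorem Ready.eval_arcExp (h : Ready κ s) {x y : IExp} {i j : Fin n} (hx : x.eval s = i)
    (hy : y.eval s = j) (b : Bool) : (arcExp b (cellExp x y)).eval s = κ ⟨(i, j), b⟩ := by
  rw [_root_.eval_arcExp, h.eval_cellExp hx hy]
  exact h.arc b (i, j)

/-- The distance matrix in the memory. -/
noncomputable def distMat (n : ℕ) (s : RAMState) (p : Fin n × Fin n) : LexCost :=
  distAt s (n * p.1 + p.2)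

theorem Ready.eval_distExp (h : Ready κ s) {x y : IExp} {i j : Fin n} (hx : x.eval s = i)
    (hy : y.eval s = j) : (distExp (cellExp x y)).eval s = distMat n s (i, j) := by
  rw [_root_.eval_distExp, h.eval_cellExp hx hy]; rfl

theorem Ready.distMat_storeDist (h : Ready κ s) {x y : IExp} {i j : Fin n} (hx : x.eval s = i)
    (hy : y.eval s = j) {v : VExp}
    (hv : (v.b.reads 12 || v.c.reads 12 || v.c.reads 13 || v.d.reads 12 || v.d.reads 13 ||
      v.d.reads 14) = false) (p : Fin n × Fin n) :
    distMat n ((storeDist (cellExp x y) v).run s) p =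
      if p = (i, j) then v.eval s else distMat n s p := by
  rw [distMat, distAt_run_storeDist _ hv, h.eval_cellExp hx hy]
  by_cases hp : p = (i, j)
  · rw [if_pos hp, if_pos (by rw [hp])]
  · rw [if_neg hp, if_neg]
    · rfl
    · intro h'; exact hp (cell_injective (q := (i, j)) |>.1 h')

theorem distMat_sameOff (hs : SameOff P s s') (hP : (P.writesN 12 || P.writesN 13 ||
    P.writesN 14 || P.writesN 15) = false) : distMat n s' = distMat n s := by
  simp only [Bool.or_eq_false_iff] at hP
  funext p
  simp [distMat, distAt, hs.2 12 hP.1.1.1, hs.2 13 hP.1.1.2, hs.2 14 hP.1.2, hs.2 15 hP.2]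

theorem Cmd.run_sameOff {p : Cmd} (hp : p.loopFree = true) (s : RAMState) :
    SameOff p s (p.run s) := by
  obtain ⟨k, -, h⟩ := Cmd.exec_run hp s
  exact h.sameOff

end

/-! ### Preparation of the memory -/

/-- Natural numbers cannot be multiplied by the machine, so the row addresses `n * i` are tabulated
by repeated addition. -/
def rowsCmd : Cmd :=
  forLoop 20 (.setI 10 (.add (.var 20) (.lit 1)) (.add (.read 10 (.var 20)) (.var 0)))

/-- Does the residual arc given by the variables `20`, `21` and a direction exist? -/
def residualTest (b : Bool) : Test :=
  .conj (.ile (.lit 1) (.read 1 (cellExp (.var 20) (.var 21))))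
    (.neg (if b then .nle (.read 2 (cellExp (.var 20) (.var 21)))
        (.read 3 (cellExp (.var 20) (.var 21)))
      else .nle (.read 3 (cellExp (.var 20) (.var 21))) (.read 1 (cellExp (.var 20) (.var 21)))))

def levelCmd (b : Bool) : Cmd :=
  .cond (residualTest b)
    (.setN (if b then 10 else 11) (cellExp (.var 20) (.var 21)) (.lit 0))
    (.setN (if b then 10 else 11) (cellExp (.var 20) (.var 21)) (.lit 1))

def levelsCmd : Cmd := forPairs (.seq (levelCmd true) (levelCmd false))

def initBody : Cmd :=
  .cond (.conj (.ile (.var 20) (.var 21)) (.ile (.var 21) (.var 20)))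
    (storeDist (cellExp (.var 20) (.var 21)) .zero)
    (.cond (VExp.leTest (arcExp true (cellExp (.var 20) (.var 21)))
        (arcExp false (cellExp (.var 21) (.var 20))))
      (storeDist (cellExp (.var 20) (.var 21)) (arcExp true (cellExp (.var 20) (.var 21))))
      (storeDist (cellExp (.var 20) (.var 21)) (arcExp false (cellExp (.var 21) (.var 20)))))

def initCmd : Cmd := forPairs initBody

def floydBody : Cmd :=
  .cond (VExp.leTest (distExp (cellExp (.var 20) (.var 21)))
      ((distExp (cellExp (.var 20) (.var 22))).add (distExp (cellExp (.var 22) (.var 21)))))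
    .skip
    (storeDist (cellExp (.var 20) (.var 21))
      ((distExp (cellExp (.var 20) (.var 22))).add (distExp (cellExp (.var 22) (.var 21)))))

def floydCmd : Cmd := forLoop 22 (forPairs floydBody)

theorem linear_le_cubic (T n : ℕ) : (T + 23) * n ≤ (T + 23) * n ^ 3 :=
  Nat.mul_le_mul_left _ (Nat.le_self_pow (by norm_num) n)

theorem quadratic_le_cubic (T : ℕ) {n : ℕ} (hn : 0 < n) :
    ((T + 23) * n + 23) * n ≤ (T + 46) * n ^ 3 := by
  have h1 : n ≤ n ^ 3 := Nat.le_self_pow (by norm_num) n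
  have h2 : n ^ 2 ≤ n ^ 3 := Nat.pow_le_pow_right hn (by norm_num)
  calc ((T + 23) * n + 23) * n = (T + 23) * n ^ 2 + 23 * n := by ring
    _ ≤ (T + 23) * n ^ 3 + 23 * n ^ 3 := by gcongr
    _ = _ := by ring

theorem cubic_le_cubic (T : ℕ) {n : ℕ} (hn : 0 < n) :
    (((T + 23) * n + 23) * n + 23) * n ≤ (T + 69) * n ^ 3 := by
  have h1 : n ≤ n ^ 3 := Nat.le_self_pow (by norm_num) n
  have h2 : n ^ 2 ≤ n ^ 3 := Nat.pow_le_pow_right hn (by norm_num)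
  calc (((T + 23) * n + 23) * n + 23) * n = (T + 23) * n ^ 3 + 23 * n ^ 2 + 23 * n := by ring
    _ ≤ (T + 23) * n ^ 3 + 23 * n ^ 3 + 23 * n ^ 3 := by gcongr
    _ = _ := by ring

theorem rowsCmd_halts : ∃ K, ∀ n, 0 < n → ∀ s : RAMState, s.idx 0 0 = n → s.idx 10 0 = 0 →
    Halts rowsCmd s (K * n ^ 3) (fun s' => ∀ i : Fin n, s'.idx 10 i = n * i) := by
  -- The constant is left open and is determined by the step bound of the loop body, which does not
  -- depend on `n`. The other timing lemmas do the same.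
  refine ⟨_, fun n hpos s hn h0 =>
    (forLoop_halts hn hpos rfl rfl (by norm_num) (fun k s => ∀ m ≤ k, s.idx 10 m = n * m)
      (fun k s x h m hm => by rw [writeI_idx, if_neg (by norm_num), h m hm]) ?_
      fun k hk s' hs hv hI => Halts.of_run rfl ?_).mono (linear_le_cubic _ n)
      fun s' _ h i => h i i.2.le⟩
  · simp [h0]
  · intro m hm
    have hn' : s'.idx 0 0 = n := by rw [hs.1 0 rfl, hn]
    simp only [Cmd.run, IExp.eval, IExp.eval_var, hv, writeI_idx, true_and, hn']
    split_ifs with h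
    · rw [hI k le_rfl, h]; ring
    · exact hI m (by omega)

open Classical in
/-- The level of a (potential) residual arc. -/
noncomputable def levelOf {n : ℕ} (N : Network n) (f : Fin n × Fin n → ℤ) (e : ResArc n) : ℝ :=
  if N.InResidual f e then 0 else 1

section

variable {n : ℕ} {N : Network n} {c₁ c₂ : Fin n × Fin n → ℝ} {lam₁ lam₂ : ℝ}
  {f : Fin n × Fin n → ℤ} {s s' s₀ : RAMState}

/-- The input is still in the memory. -/
def HasInput (s₀ s : RAMState) : Prop :=
  s.idx 0 = s₀.idx 0 ∧ s.idx 1 = s₀.idx 1 ∧ ∀ b < 7, s.num b = s₀.num b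

theorem holds_residualTest (hs : HasInput (inputState N c₁ c₂ lam₁ lam₂ f) s)
    (hrow : ∀ i : Fin n, s.idx 10 i = n * i) {i j : Fin n} (hi : s.idx 20 0 = i)
    (hj : s.idx 21 0 = j) (b : Bool) :
    (residualTest b).holds s ↔ N.InResidual f ⟨(i, j), b⟩ := by
  have hc : (cellExp (.var 20) (.var 21)).eval s = n * i + j := by
    simp [cellExp, IExp.eval, hi, hj, hrow]
  have hA : s.idx 1 (n * i + j) = if (i, j) ∈ N.A then 1 else 0 := by
    rw [hs.2.1]; exact matrixCells_apply (fun a => if a ∈ N.A then 1 else 0) (i, j)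
  have hl : s.num 1 (n * i + j) = if (i, j) ∈ N.A then (N.l (i, j) : ℝ) else 0 := by
    rw [hs.2.2 1 (by norm_num)]
    exact matrixCells_apply (fun a => if a ∈ N.A then (N.l a : ℝ) else 0) (i, j)
  have hu : s.num 2 (n * i + j) = if (i, j) ∈ N.A then (N.u (i, j) : ℝ) else 0 := by
    rw [hs.2.2 2 (by norm_num)]
    exact matrixCells_apply (fun a => if a ∈ N.A then (N.u a : ℝ) else 0) (i, j)
  have hf : s.num 3 (n * i + j) = if (i, j) ∈ N.A then (f (i, j) : ℝ) else 0 := by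
    rw [hs.2.2 3 (by norm_num)]
    exact matrixCells_apply (fun a => if a ∈ N.A then (f a : ℝ) else 0) (i, j)
  cases b <;> by_cases h : (i, j) ∈ N.A <;>
    simp [residualTest, Test.holds, IExp.eval, NExp.eval, hc, hA, hl, hu, hf, h,
      Network.InResidual]

theorem run_levelCmd (hs : HasInput (inputState N c₁ c₂ lam₁ lam₂ f) s)
    (hrow : ∀ i : Fin n, s.idx 10 i = n * i) {i j : Fin n} (hi : s.idx 20 0 = i)
    (hj : s.idx 21 0 = j) (b : Bool) :
    (levelCmd b).run s = s.writeN (if b then 10 else 11) (n * i + j) (levelOf N f ⟨(i, j), b⟩) := by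
  have hc : (cellExp (.var 20) (.var 21)).eval s = n * i + j := by
    simp [cellExp, IExp.eval, hi, hj, hrow]
  have ht := holds_residualTest hs hrow hi hj b
  by_cases h : N.InResidual f ⟨(i, j), b⟩
  · have ht := ht.2 h
    simp [levelCmd, Cmd.run, levelOf, hc, h, ht, NExp.eval]
  · have ht := mt ht.1 h
    simp [levelCmd, Cmd.run, levelOf, hc, h, ht, NExp.eval]

theorem levelsCmd_halts : ∃ K, ∀ n, 0 < n → ∀ (N : Network n) (c₁ c₂ : Fin n × Fin n → ℝ)
    (lam₁ lam₂ : ℝ) (f : Fin n × Fin n → ℤ) (s : RAMState),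
    HasInput (inputState N c₁ c₂ lam₁ lam₂ f) s → (∀ i : Fin n, s.idx 10 i = n * i) →
    Halts levelsCmd s (K * n ^ 3) (fun s' => ∀ b (p : Fin n × Fin n),
      s'.num (if b then 10 else 11) (n * p.1 + p.2) = levelOf N f ⟨p, b⟩) := by
  refine ⟨_, fun n hpos N c₁ c₂ lam₁ lam₂ f s hs hrow =>
    (forPairs_halts (n := n) (by rw [hs.1]; rfl) hpos rfl rfl rfl (fun S s => ∀ b, ∀ p ∈ S,
      s.num (if b then 10 else 11) (n * (p : Fin n × Fin n).1 + p.2) = levelOf N f ⟨p, b⟩)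
      (fun _ _ _ h => h) (fun _ _ _ h => h) (by simp)
      fun i j S s' hij hss hi hj hI => Halts.of_run rfl ?_).mono (quadratic_le_cubic _ hpos)
      fun s' _ h b p => h b p trivial⟩
  have hin : HasInput (inputState N c₁ c₂ lam₁ lam₂ f) s' := by
    refine ⟨by rw [hss.1 0 rfl, hs.1], by rw [hss.1 1 rfl, hs.2.1], fun b hb => ?_⟩
    rw [hss.2 b (by interval_cases b <;> rfl), hs.2.2 b hb]
  have hrow' : ∀ i : Fin n, s'.idx 10 i = n * i := fun i => by rw [hss.1 10 rfl, hrow]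
  rw [Cmd.run, run_levelCmd hin hrow' hi hj,
    run_levelCmd (s := s'.writeN _ _ _) (N := N) (c₁ := c₁) (c₂ := c₂) (lam₁ := lam₁)
      (lam₂ := lam₂) (f := f) ?_ hrow' hi hj]
  · intro b p hp
    have := @cell_injective n p (i, j)
    simp only [] at this
    by_cases hpij : p = (i, j)
    · subst hpij
      cases b <;> simp [writeN_num]
    · have hpS : p ∈ S := by simpa [hpij] using hp
      have hne := (not_congr this).2 hpij
      have h1 := hI b p hpS
      cases b <;> simp [writeN_num, hne] at h1 ⊢ <;> exact h1
  · refine ⟨hin.1, hin.2.1, fun b hb => ?_⟩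
    rw [← hin.2.2 b hb]
    funext a
    rw [writeN_num, if_neg]
    simp; omega

/-- Arc data, extended by `0`. -/
noncomputable def onArcs (N : Network n) (g : Fin n × Fin n → ℝ) (a : Fin n × Fin n) : ℝ :=
  if a ∈ N.A then g a else 0

/-- The lexicographic costs that the program computes. -/
noncomputable def programCost (N : Network n) (c₁ c₂ : Fin n × Fin n → ℝ) (lam₁ lam₂ : ℝ)
    (f : Fin n × Fin n → ℤ) : ResArc n → LexCost :=
  resCost N f (fun a => lam₁ * onArcs N c₁ a + lam₂ * onArcs N c₂ a) (onArcs N c₁)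

theorem ready_of_levels (hs : HasInput (inputState N c₁ c₂ lam₁ lam₂ f) s)
    (hrow : ∀ i : Fin n, s.idx 10 i = n * i)
    (h : ∀ b (p : Fin n × Fin n),
      s.num (if b then 10 else 11) (n * p.1 + p.2) = levelOf N f ⟨p, b⟩) :
    Ready (programCost N c₁ c₂ lam₁ lam₂ f) s := by
  refine ⟨by rw [hs.1]; rfl, hrow, fun b p => ?_⟩
  have h1 : s.num 4 (n * p.1 + p.2) = onArcs N c₁ p := by
    rw [hs.2.2 4 (by norm_num)]; exact matrixCells_apply (onArcs N c₁) p
  have h2 : s.num 5 (n * p.1 + p.2) = onArcs N c₂ p := by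
    rw [hs.2.2 5 (by norm_num)]; exact matrixCells_apply (onArcs N c₂) p
  have h3 : s.num 0 0 = lam₁ := by rw [hs.2.2 0 (by norm_num)]; rfl
  have h4 : s.num 0 1 = lam₂ := by rw [hs.2.2 0 (by norm_num)]; rfl
  have := h b p
  cases b <;> simp [arcExp, VExp.eval, NExp.eval, IExp.eval, negIf, h1, h2, h3, h4,
    programCost, resCost, ResArc.cost, levelOf] at this ⊢ <;> rw [this]

end

/-! ### The distance matrix: initialisation and Floyd-Warshall passes -/

theorem initCmd_halts : ∃ K, ∀ n, 0 < n → ∀ (κ : ResArc n → LexCost) (s : RAMState), Ready κ s →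
    Halts initCmd s (K * n ^ 3) (fun s' => IsPartialDist κ 0 (distMat n s')) := by
  refine ⟨_, fun n hpos κ s hs =>
    (forPairs_halts hs.size hpos rfl rfl rfl (fun S s => ∀ p ∈ S, distMat n s p =
      if p.1 = p.2 then 0 else min (κ ⟨p, true⟩) (κ ⟨p.swap, false⟩))
      (fun _ _ _ h => h) (fun _ _ _ h => h) (by simp)
      fun i j S s' hij hss hi hj hI => Halts.of_run rfl ?_).mono (quadratic_le_cubic _ hpos)
      fun s' _ h => ?_⟩
  · have hs' := hs.sameOff hss rfl
    have ht := hs'.eval_arcExp (x := .var 20) (y := .var 21) hi hj true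
    have hf := hs'.eval_arcExp (x := .var 21) (y := .var 20) hj hi false
    have hd := @Ready.distMat_storeDist _ _ _ hs' (.var 20) (.var 21) _ _ hi hj
    intro p hp
    simp only [initBody, Cmd.run, Test.holds, IExp.eval_var, hi, hj, VExp.holds_leTest, ht, hf,
      ← le_antisymm_iff, ← Fin.ext_iff]
    split_ifs with h1 h2 h2 h2
    all_goals
      rw [hd rfl]
      by_cases hpij : p = (i, j)
      · subst hpij
        simp_all [VExp.eval_zero, le_of_lt]
      · have hpS : p ∈ S := by simpa [hpij] using hp
        rw [if_neg hpij, hI p hpS]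
        simp_all
  · refine ⟨fun i => by simp [h (i, i) trivial], fun e he => ?_, fun i j => ?_,
      fun _ _ _ hk => absurd hk (Nat.not_lt_zero _)⟩
    · rw [h _ trivial, if_neg he]
      rcases e with ⟨⟨i, j⟩, _ | _⟩
      · exact min_le_right _ _
      · exact min_le_left _ _
    · rw [h _ trivial]
      by_cases hij : i = j
      · exact ⟨[], by simp [hij], by simp [hij]⟩
      · rw [if_neg hij]
        rcases min_choice (κ ⟨(i, j), true⟩) (κ ⟨(i, j).swap, false⟩) with hc | hc
        · exact ⟨[⟨(i, j), true⟩], by simp [ResArc.src, ResArc.dst], by rw [hc]; simp⟩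
        · exact ⟨[⟨(j, i), false⟩], by simp [ResArc.src, ResArc.dst], by simpa using hc.symm⟩

theorem floydCmd_halts : ∃ K, ∀ n, 0 < n → ∀ (κ : ResArc n → LexCost) (s : RAMState), Ready κ s →
    (∀ i L, IsWalk i i L → 0 ≤ (L.map κ).sum) → IsPartialDist κ 0 (distMat n s) →
    Halts floydCmd s (K * n ^ 3) (fun s' => IsPartialDist κ n (distMat n s')) := by
  classical
  refine ⟨_, fun n hpos κ s hs hκ hd =>
    (forLoop_halts hs.size hpos rfl rfl (by norm_num) (fun k s => IsPartialDist κ k (distMat n s))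
      (fun _ _ _ h => h) hd fun k hk s' hss hv hI =>
    (forPairs_halts (hs.sameOff hss rfl).size hpos rfl rfl rfl (fun S s'' => ∀ p, distMat n s'' p =
      if p ∈ S then floydPass ⟨k, hk⟩ (distMat n s') p else distMat n s' p)
      (fun _ _ _ h => h) (fun _ _ _ h => h) (by simp)
      fun i j S s'' hij hss' hi hj hI' => Halts.of_run rfl ?_).mono le_rfl fun s'' _ h => ?_).mono
      (cubic_le_cubic _ hpos) fun _ _ h => h⟩
  · have hs'' := (hs.sameOff hss rfl).sameOff hss' rfl
    have hk' : (IExp.var 22).eval s'' = (⟨k, hk⟩ : Fin n) := by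
      rw [IExp.eval_var, hss'.1 22 rfl, hv]
    have hik := hs''.eval_distExp (x := .var 20) (y := .var 22) hi hk'
    have hkj := hs''.eval_distExp (x := .var 22) (y := .var 21) hk' hj
    have hij' := hs''.eval_distExp (x := .var 20) (y := .var 21) hi hj
    have hdd := @Ready.distMat_storeDist _ _ _ hs'' (.var 20) (.var 21) _ _ hi hj
    -- The entries in row and column `k` have their old values whether or not they were already
    -- processed, and `(i, j)` itself is new. So the update in place agrees with `floydPass` on the
    -- old matrix.
    have e1 : distMat n s'' (i, ⟨k, hk⟩) = distMat n s' (i, ⟨k, hk⟩) := by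
      rw [hI']; split_ifs
      · exact floydPass_col (hI.diag _) i
      · rfl
    have e2 : distMat n s'' (⟨k, hk⟩, j) = distMat n s' (⟨k, hk⟩, j) := by
      rw [hI']; split_ifs
      · exact floydPass_row (hI.diag _) j
      · rfl
    have e3 : distMat n s'' (i, j) = distMat n s' (i, j) := by rw [hI', if_neg hij]
    rw [e1] at hik
    rw [e2] at hkj
    rw [e3] at hij'
    intro p
    simp only [floydBody, Cmd.run, VExp.holds_leTest, VExp.eval_add, hik, hkj, hij']
    by_cases hpij : p = (i, j)
    · subst hpij
      rw [if_pos (Set.mem_insert _ _)]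
      split_ifs with h
      · rw [e3, floydPass, min_eq_left h]
      · rw [hdd rfl, if_pos rfl, VExp.eval_add, hik, hkj, floydPass,
          min_eq_right (le_of_lt (not_le.1 h))]
    · have hm : p ∈ insert (i, j) S ↔ p ∈ S := by simp [hpij]
      simp only [hm, ← hI' p]
      split_ifs with h
      · rfl
      · rw [hdd rfl, if_neg hpij]
  · have : distMat n s'' = floydPass ⟨k, hk⟩ (distMat n s') := by
      funext p; rw [h p, if_pos (Set.mem_univ p)]
    rw [this]
    exact IsPartialDist.pass (k := ⟨k, hk⟩) hκ hI

/-! ### Search for the best closing arc -/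

def candidateTest (v : VExp) : Test :=
  .conj (.nle v.a (.lit 0)) (.conj (.nle (.lit 0) v.a) (.conj (.nle v.b (.lit 0))
    (.conj (.nle (.lit 0) v.b) (.neg (.nle v.c (.lit 0))))))

theorem holds_candidateTest (s : RAMState) (v : VExp) : (candidateTest v).holds s ↔
    (v.eval s).level = 0 ∧ (v.eval s).primary = 0 ∧ 0 < (v.eval s).secondary := by
  simp only [candidateTest, Test.holds, NExp.eval, VExp.eval, LexCost.level_mk,
    LexCost.primary_mk, LexCost.secondary_mk, Int.cast_zero, not_le, le_antisymm_iff, and_assoc]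

def closingExp (b : Bool) : VExp :=
  (arcExp b (cellExp (.var 20) (.var 21))).add
    (distExp (if b then cellExp (.var 21) (.var 20) else cellExp (.var 20) (.var 21)))

/-- Write the arc with the ends `x`, `y`, traversed in the direction `b`, to the variables `31`,
`32`, `33`. -/
def storeArc (x y : IExp) (b : Bool) : Cmd :=
  .seq (.setI 31 (.lit 0) x) (.seq (.setI 32 (.lit 0) y) (.setI 33 (.lit 0) (.lit (if b then 1 else 0))))

/-- Variable `30` records whether a candidate has been found, and cell `0` of number bank `20` holds
its secondary closing cost. -/
def considerCmd (b : Bool) : Cmd :=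
  .cond (.conj (candidateTest (closingExp b))
      (.neg (.conj (.ile (.lit 1) (.var 30)) (.nle (.read 20 (.lit 0)) (closingExp b).c))))
    (.seq (.setN 20 (.lit 0) (closingExp b).c) (.seq (.setI 30 (.lit 0) (.lit 1))
      (storeArc (.var 20) (.var 21) b)))
    .skip

def searchCmd : Cmd := forPairs (.seq (considerCmd true) (considerCmd false))

/-- The variables `31`, `32`, `33` hold the arc `e`. -/
def HoldsArc {n : ℕ} (s : RAMState) (e : ResArc n) : Prop :=
  s.idx 31 0 = e.arc.1 ∧ s.idx 32 0 = e.arc.2 ∧ s.idx 33 0 = if e.fwd then 1 else 0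

/-- The memory holds the best candidate in `T`. -/
def HoldsBest {n : ℕ} (κ : ResArc n → LexCost) (d : Fin n × Fin n → LexCost) (T : Set (ResArc n))
    (s : RAMState) : Prop :=
  (s.idx 30 0 = 0 ∧ ∀ e ∈ T, ¬ IsCandidate κ d e) ∨
  (s.idx 30 0 = 1 ∧ ∃ e, IsCandidate κ d e ∧ HoldsArc s e ∧
    s.num 20 0 = (closingCost κ d e).secondary ∧
    ∀ e' ∈ T, IsCandidate κ d e' → (closingCost κ d e).secondary ≤ (closingCost κ d e').secondary)

section

variable {n : ℕ} {κ : ResArc n → LexCost} {s : RAMState}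

theorem Ready.eval_closingExp (h : Ready κ s) {i j : Fin n} (hi : s.idx 20 0 = i)
    (hj : s.idx 21 0 = j) (b : Bool) :
    (closingExp b).eval s = closingCost κ (distMat n s) ⟨(i, j), b⟩ := by
  rw [closingExp, VExp.eval_add, h.eval_arcExp (x := .var 20) (y := .var 21) hi hj]
  cases b
  · rw [if_neg (by simp), h.eval_distExp (x := .var 20) (y := .var 21) hi hj]; rfl
  · rw [if_pos rfl, h.eval_distExp (x := .var 21) (y := .var 20) hj hi]; rfl

theorem HoldsBest.run_considerCmd (h : Ready κ s) {i j : Fin n} (hi : s.idx 20 0 = i)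
    (hj : s.idx 21 0 = j) (b : Bool) {T : Set (ResArc n)}
    (hT : HoldsBest κ (distMat n s) T s) :
    HoldsBest κ (distMat n s) (insert ⟨(i, j), b⟩ T) ((considerCmd b).run s) := by
  have hv := h.eval_closingExp hi hj b
  have hc : (closingExp b).c.eval s =
      (closingCost κ (distMat n s) ⟨(i, j), b⟩).secondary := by rw [← hv]; rfl
  have hcand : (candidateTest (closingExp b)).holds s ↔
      IsCandidate κ (distMat n s) ⟨(i, j), b⟩ := by
    rw [holds_candidateTest, hv]; rfl
  have htest : (Test.conj (candidateTest (closingExp b))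
      (.neg (.conj (.ile (.lit 1) (.var 30)) (.nle (.read 20 (.lit 0)) (closingExp b).c)))).holds s ↔
      IsCandidate κ (distMat n s) ⟨(i, j), b⟩ ∧ ¬ (1 ≤ s.idx 30 0 ∧
        s.num 20 0 ≤ (closingCost κ (distMat n s) ⟨(i, j), b⟩).secondary) := by
    rw [← hcand, ← hc]; rfl
  rw [considerCmd, Cmd.run]
  split_ifs with ht
  · obtain ⟨h1, h2⟩ := htest.1 ht
    refine Or.inr ⟨by simp [Cmd.run, storeArc, writeI_idx, IExp.eval], _, h1,
      ⟨by simp [Cmd.run, storeArc, writeI_idx, IExp.eval, hi],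
       by simp [Cmd.run, storeArc, writeI_idx, IExp.eval, hj],
       by simp [Cmd.run, storeArc, writeI_idx, IExp.eval]⟩,
      by simp [Cmd.run, storeArc, writeN_num, IExp.eval, hc], ?_⟩
    intro e' he' hce
    rcases Set.mem_insert_iff.1 he' with rfl | he'
    · exact le_rfl
    · rcases hT with ⟨_, hT⟩ | ⟨h30, e, he, -, hnum, hT⟩
      · exact absurd hce (hT e' he')
      · rw [h30, hnum] at h2
        have := hT e' he' hce
        simp only [le_refl, true_and, not_le] at h2
        exact h2.le.trans this
  · rw [htest] at ht
    rw [Cmd.run]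
    rcases hT with ⟨h30, hT⟩ | ⟨h30, e, he, hst, hnum, hT⟩
    · refine Or.inl ⟨h30, fun e' he' => ?_⟩
      rcases Set.mem_insert_iff.1 he' with rfl | he'
      · intro hh; exact ht ⟨hh, by simp [h30]⟩
      · exact hT e' he'
    · refine Or.inr ⟨h30, e, he, hst, hnum, fun e' he' hce => ?_⟩
      rcases Set.mem_insert_iff.1 he' with rfl | he'
      · by_contra hlt
        exact ht ⟨hce, by rw [hnum]; exact fun hh => hlt hh.2⟩
      · exact hT e' he' hce

theorem searchCmd_halts : ∃ K, ∀ n, 0 < n → ∀ (κ : ResArc n → LexCost) (s : RAMState), Ready κ s →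
    s.idx 30 0 = 0 →
    Halts searchCmd s (K * n ^ 3) (HoldsBest κ (distMat n s) Set.univ) := by
  refine ⟨_, fun n hpos κ s hs h30 =>
    (forPairs_halts hs.size hpos rfl rfl rfl
      (fun S => HoldsBest κ (distMat n s) {e | e.arc ∈ S})
      (fun _ _ _ h => h) (fun _ _ _ h => h) (Or.inl ⟨h30, by simp⟩)
      fun i j S s' hij hss hi hj hI => Halts.of_run rfl ?_).mono (quadratic_le_cubic _ hpos)
      fun s' _ h => by simpa using h⟩
  have hs' := hs.sameOff hss rfl
  have hd := distMat_sameOff (n := n) hss rfl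
  rw [← hd] at hI ⊢
  have hso := Cmd.run_sameOff (p := considerCmd true) rfl s'
  have hd' := distMat_sameOff (n := n) hso rfl
  have h1 := hI.run_considerCmd hs' hi hj true
  rw [← hd'] at h1 ⊢
  have h2 := h1.run_considerCmd (hs'.sameOff hso rfl) (by rw [hso.1 20 rfl, hi])
    (by rw [hso.1 21 rfl, hj]) false
  rw [Cmd.run]
  convert h2 using 1
  ext ⟨a, b⟩
  cases b <;> simp

end

/-! ### Construction of the cycle -/

/-- `L` is the beginning of a shortest path from `v` to `t`, which leads to `x`. -/
structure IsTrace {n : ℕ} (κ : ResArc n → LexCost) (d : Fin n × Fin n → LexCost) (v t x : Fin n)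
    (L : List (ResArc n)) : Prop where
  walk : IsWalk v x L
  cost : (L.map κ).sum + d (x, t) = d (v, t)
  nodup : (L.map ResArc.src).Nodup
  far : ∀ e ∈ L, e.src ≠ t ∧ (d (x, t)).length < (d (e.src, t)).length

/-- `e` is the first arc of a shortest path from `x` to `t`. -/
def IsFirstArc {n : ℕ} (κ : ResArc n → LexCost) (d : Fin n × Fin n → LexCost) (t x : Fin n)
    (e : ResArc n) : Prop :=
  e.src = x ∧ κ e + d (e.dst, t) ≤ d (x, t)

section

variable {n : ℕ} {κ : ResArc n → LexCost} {d : Fin n × Fin n → LexCost} {v t x : Fin n}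
  {L : List (ResArc n)}

theorem IsTrace.nil : IsTrace κ d v t v [] := ⟨by simp, by simp, by simp, by simp⟩

/-- Along a shortest path the distance to `t` drops by exactly the cost of the arc, so its last
coordinate drops by `1`. The sources visited earlier have larger values and cannot recur. -/
theorem IsTrace.snoc (hlen : ∀ e, (κ e).length = 1)
    (hκ : ∀ i L, IsWalk i i L → 0 ≤ (L.map κ).sum) (hd : IsPartialDist κ n d)
    (h : IsTrace κ d v t x L) (hx : x ≠ t) {e : ResArc n} (he : IsFirstArc κ d t x e) :
    IsTrace κ d v t e.dst (L ++ [e]) := by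
  obtain ⟨rfl, he⟩ := he
  have heq : κ e + d (e.dst, t) = d (e.src, t) := le_antisymm he (hd.le_cons hκ e t)
  have hl : 1 + (d (e.dst, t)).length = (d (e.src, t)).length := by
    rw [← heq, map_add, hlen]
  refine ⟨isWalk_append.2 ⟨_, h.walk, by simp⟩, ?_, ?_, ?_⟩
  · rw [← h.cost, ← heq]; simp [add_assoc]
  · rw [List.map_append, List.nodup_append]
    refine ⟨h.nodup, by simp, ?_⟩
    intro a ha b hb
    obtain ⟨e', he', rfl⟩ := List.mem_map.1 ha
    simp only [List.map_cons, List.map_nil, List.mem_singleton] at hb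
    subst hb
    intro hh
    have := (h.far e' he').2
    rw [hh] at this
    exact lt_irrefl _ this
  · intro e' he'
    rcases List.mem_append.1 he' with he' | he'
    · exact ⟨(h.far e' he').1, by linarith [(h.far e' he').2]⟩
    · simp only [List.mem_singleton] at he'
      subst he'
      exact ⟨hx, by linarith⟩

/-- The sources of the trace and `t` are distinct nodes. -/
theorem IsTrace.length_lt (h : IsTrace κ d v t x L) : L.length < n := by
  have : (t :: L.map ResArc.src).Nodup := by
    rw [List.nodup_cons]
    refine ⟨fun hh => ?_, h.nodup⟩
    obtain ⟨e, he, het⟩ := List.mem_map.1 hh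
    exact (h.far e he).1 het
  simpa using this.length_le_card

end

theorem IsOutput.snoc {n : ℕ} {s s' : RAMState} {C : List (ResArc n)} {e : ResArc n}
    (h : IsOutput s C) (h2 : s'.idx 2 0 = C.length + 1)
    (h3 : ∀ k, s'.idx 3 k = if k = C.length then (e.arc.1 : ℕ) else s.idx 3 k)
    (h4 : ∀ k, s'.idx 4 k = if k = C.length then (e.arc.2 : ℕ) else s.idx 4 k)
    (h5 : ∀ k, s'.idx 5 k = if k = C.length then (if e.fwd then 1 else 0) else s.idx 5 k) :
    IsOutput s' (C ++ [e]) := by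
  refine ⟨by simp [h2], fun k hk => ?_⟩
  rw [h3, h4, h5]
  simp only [List.length_append, List.length_singleton] at hk
  by_cases hkC : k = C.length
  · subst hkC; simp
  · have hk' : k < C.length := by omega
    simp only [hkC, if_false, List.getElem_append_left hk']
    exact h.2 k hk'

/-- Append the arc in the variables `31`, `32`, `33` to the output. -/
def appendCmd : Cmd :=
  .seq (.setI 3 (.var 2) (.var 31)) (.seq (.setI 4 (.var 2) (.var 32))
    (.seq (.setI 5 (.var 2) (.var 33)) (.setI 2 (.lit 0) (.add (.var 2) (.lit 1)))))

theorem IsOutput.run_appendCmd {n : ℕ} {s : RAMState} {C : List (ResArc n)} {e : ResArc n}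
    (h : IsOutput s C) (he : HoldsArc s e) : IsOutput (appendCmd.run s) (C ++ [e]) := by
  obtain ⟨h1, h2, h3⟩ := he
  refine h.snoc ?_ (fun k => ?_) (fun k => ?_) fun k => ?_ <;>
    simp [appendCmd, Cmd.run, writeI_idx, IExp.eval, h.1, h1, h2, h3]

/-- Test whether the arc between the variables `35` and `21`, in the direction `b`, is the first arc
of a shortest path from the variable `35` to the variable `36`. -/
def probeCmd (b : Bool) : Cmd :=
  .cond (VExp.leTest ((arcExp b (if b then cellExp (.var 35) (.var 21)
        else cellExp (.var 21) (.var 35))).add (distExp (cellExp (.var 21) (.var 36))))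
      (distExp (cellExp (.var 35) (.var 36))))
    (.seq (if b then storeArc (.var 35) (.var 21) b else storeArc (.var 21) (.var 35) b)
      (.setI 34 (.lit 0) (.var 21)))
    .skip

def nextArcCmd : Cmd := forLoop 21 (.seq (probeCmd true) (probeCmd false))

/-- The enclosing loop always makes `n` rounds; those after the arrival at the target do nothing. -/
def traceBody : Cmd :=
  .cond (.conj (.ile (.var 35) (.var 36)) (.ile (.var 36) (.var 35))) .skip
    (.seq nextArcCmd (.seq appendCmd (.setI 35 (.lit 0) (.var 34))))

def startCmd : Cmd :=
  .seq appendCmd (.cond (.ile (.lit 1) (.var 33))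
    (.seq (.setI 35 (.lit 0) (.var 32)) (.setI 36 (.lit 0) (.var 31)))
    (.seq (.setI 35 (.lit 0) (.var 31)) (.setI 36 (.lit 0) (.var 32))))

def cycleCmd : Cmd := .cond (.ile (.lit 1) (.var 30)) (.seq startCmd (forLoop 20 traceBody)) .skip

/-- If `T` contains a first arc of a shortest path from `x` to `t`, then the variables `31` to `34`
hold such an arc. -/
def HoldsNext {n : ℕ} (κ : ResArc n → LexCost) (d : Fin n × Fin n → LexCost) (t x : Fin n)
    (T : Set (ResArc n)) (s : RAMState) : Prop :=
  (∀ e ∈ T, ¬ IsFirstArc κ d t x e) ∨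
    ∃ e, IsFirstArc κ d t x e ∧ HoldsArc s e ∧ s.idx 34 0 = e.dst

section

variable {n : ℕ} {κ : ResArc n → LexCost} {s : RAMState} {t x u : Fin n}

theorem HoldsNext.run_probeCmd (h : Ready κ s) (hx : s.idx 35 0 = x) (ht : s.idx 36 0 = t)
    (hu : s.idx 21 0 = u) (b : Bool) {T : Set (ResArc n)}
    (hT : HoldsNext κ (distMat n s) t x T s) :
    HoldsNext κ (distMat n s) t x (insert ⟨if b then (x, u) else (u, x), b⟩ T)
      ((probeCmd b).run s) := by
  have hut := h.eval_distExp (x := .var 21) (y := .var 36) hu ht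
  have hxt := h.eval_distExp (x := .var 35) (y := .var 36) hx ht
  have hxu := h.eval_arcExp (x := .var 35) (y := .var 21) hx hu b
  have hux := h.eval_arcExp (x := .var 21) (y := .var 35) hu hx b
  have hiff : κ ⟨if b then (x, u) else (u, x), b⟩ + distMat n s (u, t) ≤ distMat n s (x, t) ↔
      IsFirstArc κ (distMat n s) t x ⟨if b then (x, u) else (u, x), b⟩ := by
    cases b <;> simp [IsFirstArc, ResArc.src, ResArc.dst]
  have htest : (VExp.leTest ((arcExp b (if b then cellExp (.var 35) (.var 21)
        else cellExp (.var 21) (.var 35))).add (distExp (cellExp (.var 21) (.var 36))))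
      (distExp (cellExp (.var 35) (.var 36)))).holds s ↔
      IsFirstArc κ (distMat n s) t x ⟨if b then (x, u) else (u, x), b⟩ := by
    rw [VExp.holds_leTest, VExp.eval_add, hut, hxt, ← hiff]
    cases b
    · simp only [Bool.false_eq_true, if_false, hux]
    · simp only [if_true, hxu]
  rw [probeCmd, Cmd.run]
  by_cases hh : IsFirstArc κ (distMat n s) t x ⟨if b then (x, u) else (u, x), b⟩
  · rw [if_pos (htest.2 hh)]
    refine Or.inr ⟨_, hh, ?_⟩
    cases b <;> simp [Cmd.run, storeArc, HoldsArc, writeI_idx, IExp.eval, hx, hu, ResArc.dst]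
  · rw [if_neg (mt htest.1 hh), Cmd.run]
    refine hT.imp_left fun hT e he => ?_
    rcases Set.mem_insert_iff.1 he with rfl | he
    · exact hh
    · exact hT e he

end

theorem nextArcCmd_halts : ∃ K, ∀ n, 0 < n → ∀ (κ : ResArc n → LexCost) (s : RAMState)
    (t x : Fin n), Ready κ s → s.idx 35 0 = x → s.idx 36 0 = t →
    (∃ e, IsFirstArc κ (distMat n s) t x e) →
    Halts nextArcCmd s (K * n) (fun s' => ∃ e, IsFirstArc κ (distMat n s) t x e ∧ HoldsArc s' e ∧
      s'.idx 34 0 = e.dst) := by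
  refine ⟨_, fun n hpos κ s t x hs hx ht hex =>
    (forLoop_halts (v := 21) hs.size hpos rfl rfl (by norm_num)
      -- After `k` rounds all arcs from `x` to the first `k` nodes have been probed, forward and
      -- backward ones.
      (fun k => HoldsNext κ (distMat n s) t x {e | e.src = x ∧ (e.dst : ℕ) < k})
      (fun _ _ _ h => h) (Or.inl (by simp))
      fun k hk s' hss hk' hI => Halts.of_run rfl ?_).mono le_rfl
      fun s' _ h => ?_⟩
  · have hs' := hs.sameOff hss rfl
    have hd := distMat_sameOff (n := n) hss rfl
    rw [← hd] at hI ⊢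
    have hso := Cmd.run_sameOff (p := probeCmd true) rfl s'
    have hd' := distMat_sameOff (n := n) hso rfl
    have hx' : s'.idx 35 0 = x := by rw [hss.1 35 rfl, hx]
    have ht' : s'.idx 36 0 = t := by rw [hss.1 36 rfl, ht]
    have h1 := hI.run_probeCmd (u := ⟨k, hk⟩) hs' hx' ht' hk' true
    rw [← hd'] at h1 ⊢
    have h2 := h1.run_probeCmd (u := ⟨k, hk⟩) (hs'.sameOff hso rfl) (by rw [hso.1 35 rfl, hx'])
      (by rw [hso.1 36 rfl, ht']) (by rw [hso.1 21 rfl, hk']) false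
    rw [Cmd.run]
    convert h2 using 1
    ext ⟨⟨a, a'⟩, b⟩
    cases b <;> simp [ResArc.src, ResArc.dst, Prod.ext_iff, Fin.ext_iff] <;> omega
  · rcases h with h | h
    · obtain ⟨e, he⟩ := hex
      exact absurd he (h e ⟨he.1, e.dst.2⟩)
    · exact h

theorem startCmd_run {n : ℕ} {s : RAMState} {e : ResArc n} (h2 : s.idx 2 0 = 0)
    (he : HoldsArc s e) : IsOutput (startCmd.run s) [e] ∧ (startCmd.run s).idx 35 0 = e.dst ∧
      (startCmd.run s).idx 36 0 = e.src := by
  have hout : IsOutput s ([] : List (ResArc n)) := ⟨h2, fun k hk => absurd hk (by simp)⟩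
  have hout := hout.run_appendCmd he
  have hso := Cmd.run_sameOff (p := appendCmd) rfl s
  have h31 : (appendCmd.run s).idx 31 0 = e.arc.1 := by rw [hso.1 31 rfl, he.1]
  have h32 : (appendCmd.run s).idx 32 0 = e.arc.2 := by rw [hso.1 32 rfl, he.2.1]
  have h33 : (appendCmd.run s).idx 33 0 = if e.fwd then 1 else 0 := by rw [hso.1 33 rfl, he.2.2]
  rw [startCmd, Cmd.run]
  generalize appendCmd.run s = s' at *
  obtain ⟨a, b⟩ := e
  cases b <;>
  simp [Cmd.run, Test.holds, IExp.eval, h31, h32, h33, writeI_idx, ResArc.src, ResArc.dst] <;>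
  simpa [IsOutput, writeI_idx] using hout

/-- After `k` rounds the trace has reached its target or has `k` arcs. A trace has fewer than `n`
arcs, so after `n` rounds the target is reached. Each round is linear in `n`, so this phase is in
fact quadratic. -/
theorem traceLoop_halts : ∃ K, ∀ n, 0 < n → ∀ (κ : ResArc n → LexCost) (s : RAMState)
    (e : ResArc n), Ready κ s → (∀ e, (κ e).length = 1) →
    (∀ i L, IsWalk i i L → 0 ≤ (L.map κ).sum) → IsPartialDist κ n (distMat n s) →
    s.idx 35 0 = e.dst → s.idx 36 0 = e.src → IsOutput s [e] →
    Halts (forLoop 20 traceBody) s (K * n ^ 3) (fun s' => ∃ L, IsOutput s' (e :: L) ∧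
      IsTrace κ (distMat n s) e.dst e.src e.src L) := by
  obtain ⟨K, hK⟩ := nextArcCmd_halts
  -- The summand `100` generously covers the test for arrival; `46` exceeds the loop overhead of
  -- `23` per round.
  refine ⟨K + ((Cmd.seq appendCmd (.setI 35 (.lit 0) (.var 34))).bound + 100) + 46,
    fun n hpos κ s e hs hlen hκ hd h35 h36 hout =>
    (forLoop_halts (v := 20) (T := K * n + ((Cmd.seq appendCmd (.setI 35 (.lit 0) (.var 34))).bound + 100))
      hs.size hpos rfl rfl (by norm_num)
      (fun k s' => ∃ L x, s'.idx 35 0 = (x : Fin n) ∧ IsOutput s' (e :: L) ∧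
        IsTrace κ (distMat n s) e.dst e.src x L ∧ (x = e.src ∨ L.length = k))
      (fun _ _ _ h => h) ⟨[], e.dst, h35, hout, .nil, Or.inr rfl⟩
      fun k hk s' hss hk' hI => ?_).mono ?_
      fun s' _ h => ?_⟩
  · obtain ⟨L, x, hx, hout, htr, hor⟩ := hI
    have hs' := hs.sameOff hss rfl
    have hdd := distMat_sameOff (n := n) hss rfl
    have ht' : s'.idx 36 0 = e.src := by rw [hss.1 36 rfl, h36]
    rw [← hdd] at htr hd ⊢
    refine (Halts.cond (T := 1)
      (T' := K * n + (Cmd.seq appendCmd (.setI 35 (.lit 0) (.var 34))).bound)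
      (fun hh => Halts.of_run (p := Cmd.skip) rfl ?_) fun hh => ?_).mono ?_ fun _ _ h => h
    · simp only [Test.holds, IExp.eval_var, hx, ht', ← le_antisymm_iff, ← Fin.ext_iff] at hh
      exact ⟨L, x, hx, hout, htr, Or.inl hh⟩
    · simp only [Test.holds, IExp.eval_var, hx, ht', ← le_antisymm_iff, ← Fin.ext_iff] at hh
      refine (hK n hpos κ s' e.src x hs' hx ht' (hd.exists_arc hκ hh)).seq ?_
      rintro s₁ hs₁ ⟨a, ha, hst, h34⟩
      refine Halts.of_run rfl ?_
      have hout₁ : IsOutput s₁ (e :: L) := by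
        simpa [IsOutput, hs₁.1 2 rfl, hs₁.1 3 rfl, hs₁.1 4 rfl, hs₁.1 5 rfl] using hout
      have hout₂ := hout₁.run_appendCmd hst
      have h34' : (appendCmd.run s₁).idx 34 0 = a.dst := by
        rw [(Cmd.run_sameOff (p := appendCmd) rfl s₁).1 34 rfl, h34]
      rw [Cmd.run]
      generalize appendCmd.run s₁ = s₂ at *
      refine ⟨L ++ [a], a.dst, by simp [Cmd.run, writeI_idx, IExp.eval, h34'],
        by simpa [Cmd.run, IsOutput, writeI_idx, IExp.eval] using hout₂,
        htr.snoc hlen hκ hd hh ha, ?_⟩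
      rcases hor with h | h
      · exact absurd h hh
      · exact Or.inr (by simp [h])
    · simp [Test.steps, IExp.steps, IExp.var]
      omega
  · have h1 : n ≤ n ^ 3 := Nat.le_self_pow (by norm_num) n
    have h2 : n ^ 2 ≤ n ^ 3 := Nat.pow_le_pow_right hpos (by norm_num)
    generalize (Cmd.seq appendCmd (.setI 35 (.lit 0) (.var 34))).bound + 100 = B
    calc (K * n + B + 23) * n = K * n ^ 2 + B * n + 23 * n := by ring
      _ ≤ K * n ^ 3 + B * n ^ 3 + 46 * n ^ 3 := by gcongr; norm_num
      _ = _ := by ring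
  · obtain ⟨L, x, hx, hout, htr, hor⟩ := h
    rcases hor with rfl | hor
    · exact ⟨L, hout, htr⟩
    · exact absurd htr.length_lt (by omega)

/-! ### The main theorem -/

/-! ### Irrelevance of the costs outside the arc set -/

section

variable {n : ℕ} {N : Network n} {w w' c c' : Fin n × Fin n → ℝ} {f : Fin n × Fin n → ℤ}
  {y : Fin n → ℝ}

theorem ResArc.cost_congr (h : ∀ a ∈ N.A, w a = w' a) {e : ResArc n} (he : e.arc ∈ N.A) :
    e.cost w = e.cost w' := by simp [ResArc.cost, h _ he]

theorem Network.IsResidualCycle.cycleCost_congr (h : ∀ a ∈ N.A, w a = w' a)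
    {C : List (ResArc n)} (hC : N.IsResidualCycle f C) : cycleCost w C = cycleCost w' C := by
  rw [cycleCost, cycleCost, List.map_congr_left fun e he => ResArc.cost_congr h (hC.2.1 e he).1]

theorem Network.reduced_congr (h : ∀ a ∈ N.A, w a = w' a) :
    N.reduced w y f = N.reduced w' y f := by
  have hr : ∀ a ∈ N.A, reducedCost w y a = reducedCost w' y a := fun a ha => by
    simp [reducedCost, h a ha]
  simp only [reduced, mk.injEq, true_and]
  refine ⟨Finset.filter_congr fun a ha => by rw [hr a ha], funext fun i => ?_⟩
  congr 1
  · congr 1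
    exact Finset.sum_congr (Finset.filter_congr fun a ha => by rw [hr a ha]) fun _ _ => rfl
  · exact Finset.sum_congr (Finset.filter_congr fun a ha => by rw [hr a ha]) fun _ _ => rfl

theorem Network.IsOptimalPotential.congr (h : ∀ a ∈ N.A, w a = w' a)
    (hy : N.IsOptimalPotential w f y) : N.IsOptimalPotential w' f y := fun e he => by
  rw [← ResArc.cost_congr h he.1]; exact hy e he

theorem Network.IsOptimalFlow.congr (h : ∀ a ∈ N.A, w a = w' a) (hf : N.IsOptimalFlow w f) :
    N.IsOptimalFlow w' f := by
  have : ∀ g, N.cost w g = N.cost w' g := fun g =>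
    Finset.sum_congr rfl fun a ha => by rw [h a ha]
  simpa only [IsOptimalFlow, this] using hf

theorem IsMinPositiveCycle.congr (h : ∀ a ∈ N.A, w a = w' a) {C : List (ResArc n)}
    (hC : IsMinPositiveCycle N f w C) : IsMinPositiveCycle N f w' C := by
  refine ⟨hC.1, hC.1.cycleCost_congr h ▸ hC.2.1, fun C' hC' hpos => ?_⟩
  rw [← hC'.cycleCost_congr h] at hpos ⊢
  rw [← hC.1.cycleCost_congr h]
  exact hC.2.2 C' hC' hpos

end

/-- The program: all distances by the Floyd-Warshall method, then the best closing arc, then the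
corresponding cycle. -/
def minCycleCmd : Cmd :=
  .seq rowsCmd (.seq levelsCmd (.seq initCmd (.seq floydCmd (.seq searchCmd cycleCmd))))

theorem HasInput.of_sameOff {s₀ s s' : RAMState} {P : Cmd} (h : HasInput s₀ s)
    (hs : SameOff P s s') (h0 : P.writesI 0 = false) (h1 : P.writesI 1 = false)
    (hN : ∀ b < 7, P.writesN b = false) : HasInput s₀ s' :=
  ⟨by rw [hs.1 0 h0, h.1], by rw [hs.1 1 h1, h.2.1], fun b hb => by rw [hs.2 b (hN b hb), h.2.2 b hb]⟩

/-- The output is a proper cheapest cycle of positive cost, if there is such a cycle. -/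
def IsSolution {n : ℕ} (N : Network n) (f : Fin n × Fin n → ℤ) (c : Fin n × Fin n → ℝ)
    (C : List (ResArc n)) : Prop :=
  (IsProperCycle C ∧ IsMinPositiveCycle N f c C) ∨
    (C = [] ∧ ∀ C', N.IsResidualCycle f C' → ¬ 0 < cycleCost c C')

theorem cycleCmd_halts : ∃ K, ∀ n, 0 < n → ∀ (N : Network n) (w c : Fin n × Fin n → ℝ)
    (f : Fin n × Fin n → ℤ) (y : Fin n → ℝ) (s : RAMState), N.IsOptimalPotential w f y →
    (N.reduced w y f).IsOptimalFlow c f → Ready (resCost N f w c) s →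
    IsPartialDist (resCost N f w c) n (distMat n s) →
    HoldsBest (resCost N f w c) (distMat n s) Set.univ s → s.idx 2 0 = 0 →
    Halts cycleCmd s (K * n ^ 3) (fun s' => ∃ C, IsOutput s' C ∧
      IsSolution (N.reduced w y f) f c C) := by
  obtain ⟨K, hK⟩ := traceLoop_halts
  refine ⟨K + (startCmd.bound + 10), fun n hpos N w c f y s hy hc hs hd hbest h2 => ?_⟩
  have hκ := resCost_closed_nonneg hy hc
  refine (Halts.cond (T := startCmd.bound + K * n ^ 3) (T' := 1) (fun hh => ?_)
    fun hh => Halts.of_run (p := Cmd.skip) rfl ?_).mono ?_ fun _ _ h => h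
  · rcases hbest with ⟨h30, -⟩ | ⟨-, e, he, hst, -, hmin⟩
    · simp [Test.holds, IExp.eval, h30] at hh
    · refine Halts.seq (Halts.of_run (Q := fun s' => IsOutput s' [e] ∧ s'.idx 35 0 = e.dst ∧
        s'.idx 36 0 = e.src) rfl (startCmd_run h2 hst)) ?_
      rintro s' hss ⟨hout, h35, h36⟩
      have hdd := distMat_sameOff (n := n) hss rfl
      rw [← hdd] at he hmin hd
      refine (hK n hpos _ s' e (hs.sameOff hss rfl) (fun _ => rfl) hκ hd h35 h36 hout).mono
        le_rfl ?_
      rintro s'' - ⟨L, hout', htr⟩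
      refine ⟨e :: L, hout', Or.inl ?_⟩
      refine isMinPositiveCycle_of_candidate hy hc hd he (fun e' => hmin e' trivial) htr.walk ?_ ?_
      -- The closing path never leaves its target, which is the source of `e`.
      · rw [List.map_cons, List.nodup_cons]
        refine ⟨fun hmem => ?_, htr.nodup⟩
        obtain ⟨e', he', het⟩ := List.mem_map.1 hmem
        exact (htr.far e' he').1 het
      · have := htr.cost
        rwa [hd.diag, add_zero] at this
  · rcases hbest with ⟨h30, hno⟩ | ⟨h30, -⟩
    · refine ⟨[], ⟨h2, fun k hk => absurd hk (by simp)⟩, Or.inr ⟨rfl, fun C' hC' hpos' => ?_⟩⟩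
      obtain ⟨e, he, -⟩ := exists_candidate_of_cycle hy hc hd hC' hpos'
      exact hno e trivial he
    · simp [Test.holds, IExp.eval, h30] at hh
  · have : 1 ≤ n ^ 3 := Nat.one_le_pow _ _ hpos
    simp only [Test.steps, IExp.steps, IExp.var]
    generalize startCmd.bound = B
    nlinarith

theorem minCycleCmd_halts : ∃ K, ∀ n, 0 < n → ∀ (N : Network n) (c₁ c₂ : Fin n × Fin n → ℝ)
    (lam₁ lam₂ : ℝ) (f : Fin n × Fin n → ℤ) (y : Fin n → ℝ),
    N.IsOptimalPotential (fun a => lam₁ * c₁ a + lam₂ * c₂ a) f y →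
    (N.reduced (fun a => lam₁ * c₁ a + lam₂ * c₂ a) y f).IsOptimalFlow c₁ f →
    Halts minCycleCmd (inputState N c₁ c₂ lam₁ lam₂ f) (K * n ^ 3) (fun s' => ∃ C, IsOutput s' C ∧
      IsSolution (N.reduced (fun a => lam₁ * c₁ a + lam₂ * c₂ a) y f) f c₁ C) := by
  obtain ⟨K₁, h₁⟩ := rowsCmd_halts
  obtain ⟨K₂, h₂⟩ := levelsCmd_halts
  obtain ⟨K₃, h₃⟩ := initCmd_halts
  obtain ⟨K₄, h₄⟩ := floydCmd_halts
  obtain ⟨K₅, h₅⟩ := searchCmd_halts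
  obtain ⟨K₆, h₆⟩ := cycleCmd_halts
  refine ⟨K₁ + (K₂ + (K₃ + (K₄ + (K₅ + K₆)))), fun n hpos N c₁ c₂ lam₁ lam₂ f y hy hc => ?_⟩
  -- The memory holds `0` outside the arc set, so the program works with the costs extended by `0`.
  -- All hypotheses are transferred to these costs, and the result is transferred back at the end.
  have hcA : ∀ (g : Fin n × Fin n → ℝ), ∀ a ∈ N.A, g a = onArcs N g a := fun g a ha => by
    simp [onArcs, ha]
  have hw : ∀ a ∈ N.A, lam₁ * c₁ a + lam₂ * c₂ a =
      (fun a => lam₁ * onArcs N c₁ a + lam₂ * onArcs N c₂ a) a := fun a ha => by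
    simp [onArcs, ha]
  have hA : ∀ a ∈ (N.reduced (fun a => lam₁ * onArcs N c₁ a + lam₂ * onArcs N c₂ a) y f).A,
      a ∈ N.A := fun a ha => (Finset.mem_filter.1 ha).1
  have hy := hy.congr hw
  rw [Network.reduced_congr hw] at hc ⊢
  have hc := hc.congr fun a ha => hcA c₁ a (hA a ha)
  have hκ := resCost_closed_nonneg hy hc
  have hin : HasInput (inputState N c₁ c₂ lam₁ lam₂ f) (inputState N c₁ c₂ lam₁ lam₂ f) :=
    ⟨rfl, rfl, fun _ _ => rfl⟩
  simp only [add_mul]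
  refine (h₁ n hpos _ rfl rfl).seq fun s₁ hs₁ hrow => ?_
  have hin₁ := hin.of_sameOff hs₁ rfl rfl (by intro b hb; interval_cases b <;> rfl)
  refine (h₂ n hpos N c₁ c₂ lam₁ lam₂ f s₁ hin₁ hrow).seq fun s₂ hs₂ hlev => ?_
  have hin₂ := hin₁.of_sameOff hs₂ rfl rfl (by intro b hb; interval_cases b <;> rfl)
  have hr₂ := ready_of_levels hin₂ (fun i => by rw [hs₂.1 10 rfl, hrow]) hlev
  refine (h₃ n hpos _ s₂ hr₂).seq fun s₃ hs₃ hd₃ => ?_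
  have hr₃ := hr₂.sameOff hs₃ rfl
  refine (h₄ n hpos _ s₃ hr₃ hκ hd₃).seq fun s₄ hs₄ hd₄ => ?_
  have hr₄ := hr₃.sameOff hs₄ rfl
  have h30 : s₄.idx 30 0 = 0 := by rw [hs₄.1 30 rfl, hs₃.1 30 rfl, hs₂.1 30 rfl, hs₁.1 30 rfl]; rfl
  have h2 : s₄.idx 2 0 = 0 := by rw [hs₄.1 2 rfl, hs₃.1 2 rfl, hs₂.1 2 rfl, hs₁.1 2 rfl]; rfl
  refine (h₅ n hpos _ s₄ hr₄ h30).seq fun s₅ hs₅ hbest => ?_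
  have hdd := distMat_sameOff (n := n) hs₅ rfl
  rw [← hdd] at hbest hd₄
  refine (h₆ n hpos N _ _ f y s₅ hy hc (hr₄.sameOff hs₅ rfl) hd₄ hbest
    (by rw [hs₅.1 2 rfl, h2])).mono le_rfl ?_
  rintro s₆ - ⟨C, hout, hsol⟩
  refine ⟨C, hout, hsol.imp (fun h => ⟨h.1, h.2.congr fun a ha => (hcA c₁ a (hA a ha)).symm⟩)
    fun h => ⟨h.1, fun C' hC' => ?_⟩⟩
  rw [hC'.cycleCost_congr fun a ha => hcA c₁ a (hA a ha)]
  exact h.2 C' hC'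

theorem mainTheorem8 :
    ∃ (P : Cmd) (K : ℕ),
      ∀ (n : ℕ), 0 < n →
      ∀ (N : Network n) (c₁ c₂ : Fin n × Fin n → ℝ) (lam₁ lam₂ : ℝ)
        (f : Fin n × Fin n → ℤ) (y : Fin n → ℝ),
      0 < lam₁ → 0 < lam₂ →
      N.IsOptimalFlow (fun a => lam₁ * c₁ a + lam₂ * c₂ a) f →
      N.IsOptimalPotential (fun a => lam₁ * c₁ a + lam₂ * c₂ a) f y →
      (N.reduced (fun a => lam₁ * c₁ a + lam₂ * c₂ a) y f).IsOptimalFlow c₁ f →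
      ∃ (t : ℕ) (s : RAMState) (C : List (ResArc n)),
        Exec P (inputState N c₁ c₂ lam₁ lam₂ f) t s ∧ t ≤ K * n ^ 3 ∧ IsOutput s C ∧
        ((IsProperCycle C ∧
            IsMinPositiveCycle (N.reduced (fun a => lam₁ * c₁ a + lam₂ * c₂ a) y f) f c₁ C) ∨
          (C = [] ∧
            ∀ C', (N.reduced (fun a => lam₁ * c₁ a + lam₂ * c₂ a) y f).IsResidualCycle f C' →
              ¬ 0 < cycleCost c₁ C')) := by
  obtain ⟨K, hK⟩ := minCycleCmd_halts
  refine ⟨minCycleCmd, K, fun n hpos N c₁ c₂ lam₁ lam₂ f y _ _ _ hy hc => ?_⟩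
  obtain ⟨t, s, he, ht, C, hout, hsol⟩ := hK n hpos N c₁ c₂ lam₁ lam₂ f y hy hc
  exact ⟨t, s, C, he, ht, hout, hsol⟩
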